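/- For $\sigma=\sigma_1\cdots\sigma_{2n}\in\mathfrak S_{2n}$ (written as a word in the letters $1,\dots,2n$; for $n=0$ there is only the empty word), a descent is a pair $(\sigma_{i-1},\sigma_i)$ with $\sigma_{i-1}>\sigma_i$; then $\sigma_{i-1}$ is a descent top and $\sigma_i$ a descent bottom, and $\mathrm{des}\,\sigma$ is the number of descents. For a letter $x$ of $\sigma$, let $l_\sigma(x)$ (resp. $r_\sigma(x)$) be the number of descents $(\sigma_{i-1},\sigma_i)$ with $\sigma_{i-1}>x>\sigma_i$ that lie to the left (resp. to the right) of $x$ in $\sigma$, and put $\mathrm{les}\,\sigma=\sum_x l_\sigma(x)$, $\mathrm{res}\,\sigma=\sum_x r_\sigma(x)$. An E-permutation of $[2n]$ is a $\sigma\in\mathfrak S_{2n}$ all of whose descents have an even top and an odd bottom, and such that for no $j\in[n]$ both $2j-1$ is a descent bottom and $2j$ is a descent top. Let $S_\sigma$ be the set of descent tops and descent bottoms of $\sigma$, and let $s(x)=\#\{y\in S_\sigma: y<x,\ y\text{ odd}\}-\#\{y\in S_\sigma: y<x,\ y\text{ even}\}+\varepsilon(x)$, where $\varepsilon(x)=1$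 if $x\notin S_\sigma$ or $x$ is odd, and $\varepsilon(x)=0$ otherwise. An E-permutation $\sigma$ is normalized if for every $j\in[n]$: (a) if $2j-1\in S_\sigma$ and $s(2j-1)$ is odd, then $l_\sigma(2j)$ is even; (b) if $2j-1\in S_\sigma$ and $s(2j-1)$ is even, then $l_\sigma(2j-1)$ is even; (c) if $2j\in S_\sigma$ and $s(2j)$ is odd, then $r_\sigma(2j-1)$ is even; (d) if $2j\in S_\sigma$ and $s(2j)$ is even, then $r_\sigma(2j)$ is even. Let $\widehat{\mathcal X}_{2n}$ be the set of normalized E-permutations of $[2n]$. Let $[n]_{p,q}=\sum_{i=0}^{n-1}p^{n-1-i}q^i$ and $\binom{n+1}{2}_{p,q}=\dfrac{[n+1]_{p,q}[n]_{p,q}}{[1]_{p,q}[2]_{p,q}}$. Let $H_{2n+1}$ ($n\ge 0$) be the median Genocchi numbers $1,2,8,56,608,\dots$, that is, the leftmost entries of the even rows of the Seidel triangle, whose first row is $1$, in which row $2k+2$ is formed by the right-to-left partial sums of row $2k+1$, and row $2k+3$ by the left-to-right partial sums of row $2k+2$ with the last sum repeated once. **Corollary.** Every $\sigma\in\widehat{\mathcal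 X}_{2n}$ satisfies $\mathrm{res}\,\sigma\ge\mathrm{des}\,\sigma$ and $\mathrm{les}\,\sigma\ge\mathrm{des}\,\sigma$. For all elements $p,q,t$ of a field with $p+q\ne 0$ (in particular for indeterminates over $\mathbb Q$), as formal power series in $x$, $$\sum_{n\ge 0}\ \sum_{\sigma\in\widehat{\mathcal X}_{2n}}p^{\mathrm{res}\,\sigma-\mathrm{des}\,\sigma}\,q^{\mathrm{les}\,\sigma-\mathrm{des}\,\sigma}\,t^{\mathrm{des}\,\sigma}\,x^n=\cfrac{1}{1-b_0x-\cfrac{\lambda_1x^2}{1-b_1x-\cfrac{\lambda_2x^2}{1-b_2x-\cdots}}}$$ with $b_{n-1}=[n]_{p,q}^2$ and $\lambda_n=\binom{n+1}{2}_{p,q}^2\,t$ for $n\ge 1$. Hence $|\widehat{\mathcal X}_{2n}|=H_{2n+1}/2^n$ for all $n\ge 0$. -/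

import Mathlib

open Finset

namespace EvenOdd

/-! ### Permutations of `[N]` as words `σ₁ σ₂ … σ_N` with letters `1, …, N` -/

/-- The letter `σ_i` of `σ` in position `i ∈ {1, …, N}` (and `0` for a position outside this range).
`Fin N` is `{0, …, N - 1}`, so positions and letters are shifted by one. -/
def letter {N : ℕ} (σ : Equiv.Perm (Fin N)) (i : ℕ) : ℕ :=
  if h : 1 ≤ i ∧ i ≤ N then (σ ⟨i - 1, by omega⟩ : ℕ) + 1 else 0

/-- The pair of adjacent letters `(σ_{i-1}, σ_i)`, with `2 ≤ i ≤ N`, is a descent. -/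
def IsDescentAt {N : ℕ} (σ : Equiv.Perm (Fin N)) (i : ℕ) : Prop :=
  2 ≤ i ∧ i ≤ N ∧ letter σ i < letter σ (i - 1)

instance {N : ℕ} (σ : Equiv.Perm (Fin N)) (i : ℕ) : Decidable (IsDescentAt σ i) := by
  unfold IsDescentAt; infer_instance

/-- The number of descents. -/
def des {N : ℕ} (σ : Equiv.Perm (Fin N)) : ℕ :=
  #{i ∈ Icc 1 N | IsDescentAt σ i}

/-- The number of pairs `(i, j)` with `2 ≤ i < j ≤ N` and `σ_{i-1} > σ_j > σ_i`. -/
def les {N : ℕ} (σ : Equiv.Perm (Fin N)) : ℕ :=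
  #{ij ∈ Icc 1 N ×ˢ Icc 1 N | 2 ≤ ij.1 ∧ ij.1 < ij.2 ∧
    letter σ (ij.1 - 1) > letter σ ij.2 ∧ letter σ ij.2 > letter σ ij.1}

/-- The number of pairs `(i, j)` with `1 ≤ i < j ≤ N - 1` and `σ_j > σ_i > σ_{j+1}`. -/
def res {N : ℕ} (σ : Equiv.Perm (Fin N)) : ℕ :=
  #{ij ∈ Icc 1 N ×ˢ Icc 1 N | ij.1 < ij.2 ∧ ij.2 + 1 ≤ N ∧
    letter σ ij.2 > letter σ ij.1 ∧ letter σ ij.1 > letter σ (ij.2 + 1)}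

/-- `l_σ(x)`: the number of left-embracings of the letter `x = σ_j`, that is, of descents
`(σ_{i-1}, σ_i)` with `i < j` and `σ_{i-1} > x > σ_i`. -/
def leftEmb {N : ℕ} (σ : Equiv.Perm (Fin N)) (x : ℕ) : ℕ :=
  #{ij ∈ Icc 1 N ×ˢ Icc 1 N | letter σ ij.2 = x ∧ 2 ≤ ij.1 ∧ ij.1 < ij.2 ∧
    letter σ (ij.1 - 1) > x ∧ x > letter σ ij.1}

/-- `r_σ(x)`: the number of right-embracings of the letter `x = σ_i`, that is, of descents
`(σ_j, σ_{j+1})` with `i < j` and `σ_j > x > σ_{j+1}`. -/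
def rightEmb {N : ℕ} (σ : Equiv.Perm (Fin N)) (x : ℕ) : ℕ :=
  #{ij ∈ Icc 1 N ×ˢ Icc 1 N | letter σ ij.1 = x ∧ ij.1 < ij.2 ∧ ij.2 + 1 ≤ N ∧
    letter σ ij.2 > x ∧ x > letter σ (ij.2 + 1)}

/-- The set of descent tops. -/
def descentTops {N : ℕ} (σ : Equiv.Perm (Fin N)) : Finset ℕ :=
  {i ∈ Icc 1 N | IsDescentAt σ i}.image fun i => letter σ (i - 1)

/-- The set of descent bottoms. -/
def descentBottoms {N : ℕ} (σ : Equiv.Perm (Fin N)) : Finset ℕ :=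
  {i ∈ Icc 1 N | IsDescentAt σ i}.image fun i => letter σ i

/-- `S_σ`: the set of descent tops and descent bottoms. -/
def signature {N : ℕ} (σ : Equiv.Perm (Fin N)) : Finset ℕ :=
  descentTops σ ∪ descentBottoms σ

/-- The signature function
`s(x) = S_o(x) - S_e(x) + (1 if x ∈ S is odd or x ∉ S)`,
where `S_o(x)` and `S_e(x)` are the numbers of odd and even elements of `S` less than `x`. -/
def sigFun (S : Finset ℕ) (x : ℕ) : ℤ :=
  (#{y ∈ S | Odd y ∧ y < x} : ℤ) - (#{y ∈ S | Even y ∧ y < x} : ℤ) +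
    (if (x ∈ S ∧ Odd x) ∨ x ∉ S then 1 else 0)

/-! ### Even-odd descent permutations, E-permutations, normalized E-permutations -/

/-- Every descent `(σ_{i-1}, σ_i)` has `σ_{i-1}` even and `σ_i` odd. -/
def IsEvenOdd {n : ℕ} (σ : Equiv.Perm (Fin (2 * n))) : Prop :=
  ∀ i ∈ Icc 1 (2 * n), IsDescentAt σ i → Even (letter σ (i - 1)) ∧ Odd (letter σ i)

/-- An even-odd descent permutation for which there is no `j ∈ [n]` such that `2j - 1` is a descent
bottom and `2j` is a descent top. -/
def IsEPerm {n : ℕ} (σ : Equiv.Perm (Fin (2 * n))) : Prop :=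
  IsEvenOdd σ ∧ ∀ j ∈ Icc 1 n, ¬ (2 * j - 1 ∈ descentBottoms σ ∧ 2 * j ∈ descentTops σ)

/-- Normalized E-permutations. -/
def IsNormalized {n : ℕ} (σ : Equiv.Perm (Fin (2 * n))) : Prop :=
  IsEPerm σ ∧ ∀ j ∈ Icc 1 n,
    (2 * j - 1 ∈ signature σ → Odd (sigFun (signature σ) (2 * j - 1)) →
      Even (leftEmb σ (2 * j))) ∧
    (2 * j - 1 ∈ signature σ → Even (sigFun (signature σ) (2 * j - 1)) →
      Even (leftEmb σ (2 * j - 1))) ∧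
    (2 * j ∈ signature σ → Odd (sigFun (signature σ) (2 * j)) →
      Even (rightEmb σ (2 * j - 1))) ∧
    (2 * j ∈ signature σ → Even (sigFun (signature σ) (2 * j)) →
      Even (rightEmb σ (2 * j)))

instance {n : ℕ} (σ : Equiv.Perm (Fin (2 * n))) : Decidable (IsNormalized σ) := by
  unfold IsNormalized IsEPerm IsEvenOdd; infer_instance

/-- The set of normalized E-permutations of `[2n]`. -/
def normalizedEPerms (n : ℕ) : Finset (Equiv.Perm (Fin (2 * n))) :=
  {σ | IsNormalized σ}

/-! ### `(p, q)`-analogues -/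

/-- `[n]_{p,q} = p^{n-1} + p^{n-2} q + ⋯ + q^{n-1}`. -/
def pqNat {R : Type*} [CommSemiring R] (p q : R) (n : ℕ) : R :=
  ∑ i ∈ range n, p ^ (n - 1 - i) * q ^ i

/-- `[n]_{p,q} ⋯ [n-k+1]_{p,q} / ([1]_{p,q} ⋯ [k]_{p,q})`, for `k ≤ n`. -/
noncomputable def pqBinom {K : Type*} [Field K] (p q : K) (n k : ℕ) : K :=
  (∏ i ∈ range k, pqNat p q (n - i)) / ∏ i ∈ range k, pqNat p q (i + 1)

/-! ### J-fractions as formal power series -/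

/-- The finite continued fraction
`1 / (1 - b_k x - λ_{k+1} x² / (1 - b_{k+1} x - λ_{k+2} x² / ( ⋯ / (1 - b_{k+m-1} x))))`
with `m` levels, a formal power series in `x` (and `0` for `m = 0`). -/
noncomputable def jConvergent {K : Type*} [Field K] (b lam : ℕ → K) :
    ℕ → ℕ → PowerSeries K
  | 0, _ => 0
  | m + 1, k => (1 - PowerSeries.C (b k) * PowerSeries.X -
      PowerSeries.C (lam (k + 1)) * PowerSeries.X ^ 2 * jConvergent b lam m (k + 1))⁻¹

/-- `F` is the value of the infinite J-fraction
`1 / (1 - b₀ x - λ₁ x² / (1 - b₁ x - λ₂ x² / ( ⋯ )))`: the convergents tend to `F` in the ring of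
formal power series, that is, each coefficient is eventually equal to that of `F`. -/
def HasJFraction {K : Type*} [Field K] (F : PowerSeries K) (b lam : ℕ → K) : Prop :=
  ∀ n : ℕ, ∀ᶠ m in Filter.atTop,
    PowerSeries.coeff n (jConvergent b lam m 0) = PowerSeries.coeff n F

/-! ### Median Genocchi numbers through the Seidel triangle -/

/-- The row of the Seidel triangle that is obtained from a row `u₀, …, u_k` by summing from right
to left: its entry in column `j` is `u_j + u_{j+1} + ⋯ + u_k`. -/
def seidelBack (k : ℕ) (u : ℕ → ℕ) (j : ℕ) : ℕ := ∑ i ∈ Icc j k, u i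

/-- The row `2k + 1` of the Seidel triangle, with entries in the columns `0, …, k`. Row `1` is `1`,
row `2k + 2` is obtained from row `2k + 1` by summing from right to left, and row `2k + 3` from row
`2k + 2` by summing from left to right, with the last sum written twice. -/
def seidelOddRow : ℕ → ℕ → ℕ
  | 0 => fun j => if j = 0 then 1 else 0
  | k + 1 => fun j => ∑ i ∈ range (j + 1), seidelBack k (seidelOddRow k) i

/-- The median Genocchi number `H_{2n+1}`, the leftmost entry of row `2n + 2` of the Seidel
triangle: `1, 2, 8, 56, 608, …` for `n = 0, 1, 2, 3, 4, …`. -/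
def medianGenocchi (n : ℕ) : ℕ := seidelBack n (seidelOddRow n) 0

end EvenOdd

namespace EvenOdd

/-! Read the letters in increasing order and record for each `x` whether it is a descent top,
whether it is a descent bottom, and `l(x)`. The number `h` of descents crossing the level `x` goes
up at a letter that is only a bottom and down at a letter that is only a top, while `l(x) + r(x)` is
`h`, or `h - 1` at a top. This record determines the permutation (`eq_of_step_eq`), and there are
exactly `N!` admissible records (`card_histories`), so sums over permutations become sums over
histories (`sum_code`).

Now group the letters `2j - 1, 2j`. In an E-permutation such a pair contains no descent letter, or
only a bottom `2j - 1`, or only a top `2j`: a level, up or down step of a Motzkin path. The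
signature function is the height up to a shift by one, so normalization is a parity condition inside
each pair. Without it the embracing numbers would contribute `[h+1]²`, `[h+1][h+2]` and `[h+1][h]`.
For up and down steps the parity condition falls on the factor with an even number of terms and,
with one exponent lowered by one, divides it by `p + q` (`sum_pairWeight`). Flajolet's
correspondence turns Motzkin paths into the J-fraction (`hasJFraction_motzkin`).

For the cardinality, the even rows of the Seidel triangle are written as `± φ(X^(n+j) (X+1)^(n-j))`
for a linear functional `φ` on `ℚ[X]` (`seidelBack_eq`); taking partial sums amounts to the relation
`(X + 1) - X = 1`. The leftmost entries are then the values `φ((-X(X+1))^n)`, and these follow the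
Motzkin recurrence at `p = q = t = 1`, rescaled by `2^n` (`functional_moments`). -/

/-! ### Letters and positions -/

section Words

variable {N : ℕ} (σ : Equiv.Perm (Fin N))

/-- The position of the letter `x`. -/
def pos (x : ℕ) : ℕ := letter σ⁻¹ x

lemma letter_mem {i : ℕ} (hi : 1 ≤ i ∧ i ≤ N) : 1 ≤ letter σ i ∧ letter σ i ≤ N := by
  unfold letter
  rw [dif_pos hi]
  omega

lemma letter_inv_letter {i : ℕ} (hi : 1 ≤ i ∧ i ≤ N) : letter σ⁻¹ (letter σ i) = i := by
  have h := letter_mem σ hi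
  unfold letter at h ⊢
  rw [dif_pos hi] at h ⊢
  rw [dif_pos h]
  simp
  omega

lemma pos_letter {i : ℕ} (hi : 1 ≤ i ∧ i ≤ N) : pos σ (letter σ i) = i :=
  letter_inv_letter σ hi

lemma letter_pos {x : ℕ} (hx : 1 ≤ x ∧ x ≤ N) : letter σ (pos σ x) = x := by
  simpa [pos] using letter_inv_letter σ⁻¹ hx

lemma pos_mem {x : ℕ} (hx : 1 ≤ x ∧ x ≤ N) : 1 ≤ pos σ x ∧ pos σ x ≤ N := letter_mem σ⁻¹ hx

lemma letter_eq_iff {i x : ℕ} (hi : 1 ≤ i ∧ i ≤ N) (hx : 1 ≤ x ∧ x ≤ N) :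
    letter σ i = x ↔ i = pos σ x := by
  constructor
  · rintro rfl
    exact (pos_letter σ hi).symm
  · rintro rfl
    exact letter_pos σ hx

lemma letter_injOn {i j : ℕ} (hi : 1 ≤ i ∧ i ≤ N) (hj : 1 ≤ j ∧ j ≤ N)
    (h : letter σ i = letter σ j) : i = j := by
  rw [← pos_letter σ hi, h, pos_letter σ hj]

lemma mem_descentBottoms {x : ℕ} (hx : 1 ≤ x ∧ x ≤ N) :
    x ∈ descentBottoms σ ↔ 2 ≤ pos σ x ∧ x < letter σ (pos σ x - 1) := by
  simp only [descentBottoms, mem_image, mem_filter, mem_Icc]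
  constructor
  · rintro ⟨i, ⟨hi, h2, -, h⟩, rfl⟩
    rw [pos_letter σ hi]
    exact ⟨h2, h⟩
  · rintro ⟨h2, h⟩
    exact ⟨pos σ x, ⟨pos_mem σ hx, h2, (pos_mem σ hx).2, by rwa [letter_pos σ hx]⟩,
      letter_pos σ hx⟩

lemma mem_descentTops {x : ℕ} (hx : 1 ≤ x ∧ x ≤ N) :
    x ∈ descentTops σ ↔ pos σ x + 1 ≤ N ∧ letter σ (pos σ x + 1) < x := by
  simp only [descentTops, mem_image, mem_filter, mem_Icc]
  constructor
  · rintro ⟨i, ⟨hi, h2, -, h⟩, rfl⟩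
    rw [pos_letter σ (by omega), Nat.sub_add_cancel (by omega)]
    exact ⟨hi.2, h⟩
  · rintro ⟨h2, h⟩
    have := pos_mem σ hx
    exact ⟨pos σ x + 1, ⟨by omega, by omega, h2, by simpa [letter_pos σ hx] using h⟩,
      by simpa using letter_pos σ hx⟩

lemma mem_range_of_mem_descentTops {x : ℕ} (h : x ∈ descentTops σ) : 1 ≤ x ∧ x ≤ N := by
  simp only [descentTops, mem_image, mem_filter, mem_Icc] at h
  obtain ⟨i, ⟨hi, h2, -, h⟩, rfl⟩ := h
  exact letter_mem σ (by omega)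

lemma mem_range_of_mem_descentBottoms {x : ℕ} (h : x ∈ descentBottoms σ) : 1 ≤ x ∧ x ≤ N := by
  simp only [descentBottoms, mem_image, mem_filter, mem_Icc] at h
  obtain ⟨i, ⟨hi, h2, -, h⟩, rfl⟩ := h
  exact letter_mem σ (by omega)

lemma card_descentBottoms : #(descentBottoms σ) = des σ := by
  rw [descentBottoms, card_image_of_injOn, des]
  intro i hi j hj h
  simp only [coe_filter, mem_Icc, Set.mem_ofPred_eq] at hi hj
  exact letter_injOn σ hi.1 hj.1 h

/-! ### Descents crossing a level -/

/-- The positions `i` of the descents `(σ_{i-1}, σ_i)` with `σ_i < x ≤ σ_{i-1}`. -/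
def openAt (x : ℕ) : Finset ℕ :=
  {i ∈ Icc 2 N | letter σ i < x ∧ x ≤ letter σ (i - 1)}

lemma mem_openAt {x i : ℕ} :
    i ∈ openAt σ x ↔ (2 ≤ i ∧ i ≤ N) ∧ letter σ i < x ∧ x ≤ letter σ (i - 1) := by
  simp [openAt]

/-- The number of descents crossing the level `x`. -/
def height (x : ℕ) : ℕ := #(openAt σ x)

lemma height_one : height σ 1 = 0 := by
  rw [height, card_eq_zero, eq_empty_iff_forall_notMem]
  intro i hi
  rw [mem_openAt] at hi
  have := letter_mem σ (i := i) (by omega)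
  omega

lemma height_last : height σ (N + 1) = 0 := by
  rw [height, card_eq_zero, eq_empty_iff_forall_notMem]
  intro i hi
  rw [mem_openAt] at hi
  have := letter_mem σ (i := i - 1) (by omega)
  omega

/-- Adding the descent with top `x` to those crossing `x + 1`, or the descent with bottom `x` to
those crossing `x`, gives the same set: the descents with `σ_i ≤ x ≤ σ_{i-1}`. -/
lemma height_succ {x : ℕ} (hx : 1 ≤ x ∧ x ≤ N) :
    height σ (x + 1) + (if x ∈ descentTops σ then 1 else 0) =
      height σ x + (if x ∈ descentBottoms σ then 1 else 0) := by
  have hp := pos_mem σ hx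
  have hl := letter_pos σ hx
  have key : openAt σ (x + 1) ∪ (if x ∈ descentTops σ then {pos σ x + 1} else ∅) =
      openAt σ x ∪ (if x ∈ descentBottoms σ then {pos σ x} else ∅) := by
    simp only [mem_descentTops σ hx, mem_descentBottoms σ hx]
    ext i
    simp only [mem_union, mem_openAt]
    by_cases hi : 2 ≤ i ∧ i ≤ N
    · have h1 : letter σ i = x ↔ i = pos σ x := letter_eq_iff σ (by omega) hx
      have h2 : letter σ (i - 1) = x ↔ i - 1 = pos σ x := letter_eq_iff σ (by omega) hx
      have h3 : (i ∈ if pos σ x + 1 ≤ N ∧ letter σ (pos σ x + 1) < x then {pos σ x + 1} else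
          (∅ : Finset ℕ)) ↔ i = pos σ x + 1 ∧ letter σ i < x := by
        split_ifs with h <;> simp
        · rintro rfl; exact h.2
        · rintro rfl; rw [not_and] at h; simpa using h hi.2
      have h4 : (i ∈ if 2 ≤ pos σ x ∧ x < letter σ (pos σ x - 1) then {pos σ x} else
          (∅ : Finset ℕ)) ↔ i = pos σ x ∧ x < letter σ (i - 1) := by
        split_ifs with h <;> simp
        · rintro rfl; exact h.2
        · rintro rfl; rw [not_and] at h; simpa using h hi.1
      rw [h3, h4]
      omega
    · have h3 : ¬ (i ∈ if pos σ x + 1 ≤ N ∧ letter σ (pos σ x + 1) < x then {pos σ x + 1} else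
          (∅ : Finset ℕ)) := by
        split_ifs with h <;> simp
        omega
      have h4 : ¬ (i ∈ if 2 ≤ pos σ x ∧ x < letter σ (pos σ x - 1) then {pos σ x} else
          (∅ : Finset ℕ)) := by
        split_ifs with h <;> simp
        omega
      simp only [h3, h4, hi, false_and, or_self]
  have d1 : Disjoint (openAt σ (x + 1)) (if x ∈ descentTops σ then {pos σ x + 1} else ∅) := by
    split_ifs
    · simp [mem_openAt, hl]
    · simp
  have d2 : Disjoint (openAt σ x) (if x ∈ descentBottoms σ then {pos σ x} else ∅) := by
    split_ifs
    · simp [mem_openAt, hl]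
    · simp
  have := congrArg card key
  rw [card_union_of_disjoint d1, card_union_of_disjoint d2] at this
  simpa only [height, apply_ite card, card_singleton, card_empty] using this

lemma leftEmb_eq {x : ℕ} (hx : 1 ≤ x ∧ x ≤ N) :
    leftEmb σ x = #{i ∈ openAt σ x | i < pos σ x} := by
  have hp := pos_mem σ hx
  rw [leftEmb]
  refine card_nbij' (fun ij => ij.1) (fun i => (i, pos σ x)) ?_ ?_ ?_ ?_
  · rintro ⟨i, j⟩ h
    simp only [coe_filter, mem_product, mem_Icc, Set.mem_ofPred_eq, mem_openAt] at h ⊢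
    have := (letter_eq_iff σ h.1.2 hx).1 h.2.1
    omega
  · intro i h
    simp only [coe_filter, mem_product, mem_Icc, Set.mem_ofPred_eq, mem_openAt] at h ⊢
    have h1 : i - 1 ≠ pos σ x := by omega
    have h2 : letter σ (i - 1) = x ↔ i - 1 = pos σ x := letter_eq_iff σ (by omega) hx
    exact ⟨by omega, letter_pos σ hx, by omega, h.2, by omega, by omega⟩
  · rintro ⟨i, j⟩ h
    simp only [coe_filter, mem_product, mem_Icc, Set.mem_ofPred_eq] at h ⊢
    rw [(letter_eq_iff σ h.1.2 hx).1 h.2.1]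
  · intro i h
    rfl

/-- A crossing descent is recorded by the position of its bottom. The index `pos σ x + 1` would be a
descent starting at `x` itself, which does not embrace `x`. -/
lemma rightEmb_eq {x : ℕ} (hx : 1 ≤ x ∧ x ≤ N) :
    rightEmb σ x = #{i ∈ openAt σ x | pos σ x + 1 < i} := by
  have hp := pos_mem σ hx
  rw [rightEmb]
  refine card_nbij' (fun ij => ij.2 + 1) (fun i => (pos σ x, i - 1)) ?_ ?_ ?_ ?_
  · rintro ⟨i, j⟩ h
    simp only [coe_filter, mem_product, mem_Icc, Set.mem_ofPred_eq, mem_openAt] at h ⊢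
    have := (letter_eq_iff σ h.1.1 hx).1 h.2.1
    simp only [Nat.add_sub_cancel]
    omega
  · intro i h
    simp only [coe_filter, mem_product, mem_Icc, Set.mem_ofPred_eq, mem_openAt] at h ⊢
    have h2 : letter σ (i - 1) = x ↔ i - 1 = pos σ x := letter_eq_iff σ (by omega) hx
    rw [Nat.sub_add_cancel (by omega)]
    exact ⟨by omega, letter_pos σ hx, by omega, by omega, by omega, by omega⟩
  · rintro ⟨i, j⟩ h
    simp only [coe_filter, mem_product, mem_Icc, Set.mem_ofPred_eq] at h ⊢
    rw [(letter_eq_iff σ h.1.1 hx).1 h.2.1]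
    simp
  · intro i h
    simp only [coe_filter, Set.mem_ofPred_eq] at h ⊢
    omega

/-- Every descent crossing the level `x` is a left or a right embracing of `x`, or starts at `x`. -/
lemma leftEmb_add_rightEmb {x : ℕ} (hx : 1 ≤ x ∧ x ≤ N) :
    leftEmb σ x + rightEmb σ x + (if x ∈ descentTops σ then 1 else 0) = height σ x := by
  have hp := pos_mem σ hx
  have hl := letter_pos σ hx
  rw [leftEmb_eq σ hx, rightEmb_eq σ hx, height,
    ← card_filter_add_card_filter_not (s := openAt σ x) (fun i => i < pos σ x), add_assoc]
  congr 1
  rw [← card_filter_add_card_filter_not (s := {i ∈ openAt σ x | ¬ i < pos σ x})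
    (fun i => pos σ x + 1 < i)]
  congr 1
  · rw [filter_filter]
    congr 1
    ext i
    simp only [mem_filter]
    constructor <;> rintro ⟨h, h'⟩ <;> exact ⟨h, by omega⟩
  · rw [filter_filter]
    have : {i ∈ openAt σ x | ¬ i < pos σ x ∧ ¬ pos σ x + 1 < i} =
        if x ∈ descentTops σ then {pos σ x + 1} else ∅ := by
      simp only [mem_descentTops σ hx]
      ext i
      have : i ∈ openAt σ x → i ≠ pos σ x := by
        rintro h rfl
        simp [mem_openAt, hl] at h
      constructor
      · intro h
        rw [mem_filter] at h
        have hi : i = pos σ x + 1 := by have := this h.1; omega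
        have h' := (mem_openAt σ).1 h.1
        rw [hi] at h'
        rw [if_pos ⟨h'.1.2, h'.2.1⟩, hi]
        simp
      · split_ifs with h
        · simp only [mem_singleton, mem_filter, mem_openAt]
          rintro rfl
          simp [hl, h]
          omega
        · simp
    rw [this, apply_ite card]
    simp

lemma les_eq_sum : les σ = ∑ x ∈ Icc 1 N, leftEmb σ x := by
  rw [les, card_eq_sum_card_fiberwise (f := fun ij => letter σ ij.2) (t := Icc 1 N)]
  · refine sum_congr rfl fun x hx => ?_
    rw [leftEmb, filter_filter]
    congr 1
    ext ij
    simp only [mem_filter]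
    constructor
    · rintro ⟨h, h', rfl⟩; tauto
    · rintro ⟨h, rfl, h'⟩; tauto
  · intro ij h
    simp only [coe_filter, mem_product, mem_Icc, Set.mem_ofPred_eq, coe_Icc, Set.mem_Icc] at h ⊢
    exact letter_mem σ h.1.2

lemma res_eq_sum : res σ = ∑ x ∈ Icc 1 N, rightEmb σ x := by
  rw [res, card_eq_sum_card_fiberwise (f := fun ij => letter σ ij.1) (t := Icc 1 N)]
  · refine sum_congr rfl fun x hx => ?_
    rw [rightEmb, filter_filter]
    congr 1
    ext ij
    simp only [mem_filter]
    constructor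
    · rintro ⟨h, h', rfl⟩; tauto
    · rintro ⟨h, rfl, h'⟩; tauto
  · intro ij h
    simp only [coe_filter, mem_product, mem_Icc, Set.mem_ofPred_eq, coe_Icc, Set.mem_Icc] at h ⊢
    exact letter_mem σ h.1.1

lemma des_eq_sum : des σ = ∑ x ∈ Icc 1 N, if x ∈ descentBottoms σ then 1 else 0 := by
  rw [← card_descentBottoms, ← card_filter]
  congr 1
  ext x
  simp only [mem_filter, mem_Icc]
  exact ⟨fun h => ⟨mem_range_of_mem_descentBottoms σ h, h⟩, fun h => h.2⟩

lemma height_add_card_tops {x : ℕ} (hx : 1 ≤ x) (hN : x ≤ N + 1) :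
    height σ x + #{y ∈ descentTops σ | y < x} = #{y ∈ descentBottoms σ | y < x} := by
  induction x, hx using Nat.le_induction with
  | base =>
    rw [height_one, filter_false_of_mem, filter_false_of_mem]
    · simp
    · intro y hy; have := mem_range_of_mem_descentBottoms σ hy; omega
    · intro y hy; have := mem_range_of_mem_descentTops σ hy; omega
  | succ x hx ih =>
    have h := height_succ σ (x := x) (by omega)
    have ih := ih (by omega)
    have split : ∀ s : Finset ℕ, #{y ∈ s | y < x + 1} =
        #{y ∈ s | y < x} + if x ∈ s then 1 else 0 := by
      intro s
      have : {y ∈ s | y < x + 1} = {y ∈ s | y < x} ∪ if x ∈ s then {x} else ∅ := by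
        ext y
        split_ifs with hs
        · simp only [mem_filter, mem_union, mem_singleton, Nat.lt_succ_iff_lt_or_eq]
          constructor
          · tauto
          · rintro (h | rfl) <;> tauto
        · simp only [mem_filter, mem_union, notMem_empty, or_false, Nat.lt_succ_iff_lt_or_eq]
          constructor
          · rintro ⟨h, h' | rfl⟩ <;> tauto
          · tauto
      rw [this, card_union_of_disjoint, apply_ite card]
      · simp
      · split_ifs <;> simp
    rw [split, split]
    omega

end Words

/-! ### A permutation is determined by its types and left embracing numbers -/

section Code

variable {N : ℕ} (σ τ : Equiv.Perm (Fin N))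

/-- The type of the letter `x` (is it a descent top, is it a descent bottom), together with
`l_σ(x)`. -/
def step (x : ℕ) : Bool × Bool × ℕ :=
  (decide (x ∈ descentTops σ), decide (x ∈ descentBottoms σ), leftEmb σ x)

/-- The sequence of the steps of the letters `1, …, N`. -/
def code : List (Bool × Bool × ℕ) := (List.range' 1 N).map (step σ)

/-- Between a letter at least `x` and a later letter below `x` there is a descent crossing `x`. -/
lemma exists_openAt {x i j : ℕ} (hi : 1 ≤ i) (hij : i < j) (hj : j ≤ N)
    (h1 : x ≤ letter σ i) (h2 : letter σ j < x) : ∃ k ∈ openAt σ x, i < k ∧ k ≤ j := by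
  induction j, hij using Nat.le_induction with
  | base => exact ⟨i + 1, (mem_openAt σ).2 ⟨by omega, h2, by simpa using h1⟩, by omega, le_rfl⟩
  | succ j hij ih =>
    rcases lt_or_ge (letter σ j) x with h | h
    · obtain ⟨k, hk, h3, h4⟩ := ih (by omega) h
      exact ⟨k, hk, h3, by omega⟩
    · exact ⟨j + 1, (mem_openAt σ).2 ⟨by omega, h2, by simpa using h⟩, by omega, le_rfl⟩

/-- The relative position of `x` and a smaller letter in terms of left embracings. -/
lemma pos_lt_pos_iff {a x : ℕ} (ha : 1 ≤ a) (hax : a < x) (hx : x ≤ N) :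
    pos σ a < pos σ x ↔ #{i ∈ openAt σ x | i ≤ pos σ a} ≤ leftEmb σ x := by
  have hxN : 1 ≤ x ∧ x ≤ N := by omega
  have haN : 1 ≤ a ∧ a ≤ N := by omega
  have hpx := pos_mem σ hxN
  have hpa := pos_mem σ haN
  rw [leftEmb_eq σ hxN]
  constructor
  · intro h
    refine card_le_card fun i hi => ?_
    rw [mem_filter] at hi ⊢
    exact ⟨hi.1, by omega⟩
  · intro h
    by_contra hlt
    have hne : pos σ a ≠ pos σ x := by
      intro h
      have := letter_pos σ hxN
      rw [← h, letter_pos σ haN] at this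
      omega
    -- If `a` came after `x`, a crossing descent would lie between them: it is counted up to `a` but
    -- not among the left embracings of `x`, so the inequality would fail.
    obtain ⟨k, hk, h3, h4⟩ := exists_openAt σ (x := x) hpx.1 (by omega : pos σ x < pos σ a) hpa.2
      (letter_pos σ hxN).ge (by rwa [letter_pos σ haN])
    refine absurd h (not_le.2 (card_lt_card ?_))
    rw [ssubset_iff_of_subset]
    · exact ⟨k, by simp [hk, h4], by simp; omega⟩
    · intro i hi
      rw [mem_filter] at hi ⊢
      exact ⟨hi.1, by omega⟩

/-- Whether the descent to `b` is crossing the level `x` depends only on the order and the types of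
the letters below `x`. -/
lemma pos_mem_openAt_iff {b x : ℕ} (hb : 1 ≤ b) (hbx : b < x) (hx : x ≤ N) :
    pos σ b ∈ openAt σ x ↔ b ∈ descentBottoms σ ∧ ¬ ∃ c ∈ Ico 1 x, c ∈ descentTops σ ∧
      pos σ c < pos σ b ∧ ∀ d ∈ Ico 1 x, ¬ (pos σ c < pos σ d ∧ pos σ d < pos σ b) := by
  have hbN : 1 ≤ b ∧ b ≤ N := by omega
  have hpb := pos_mem σ hbN
  rw [mem_openAt, mem_descentBottoms σ hbN, letter_pos σ hbN]
  constructor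
  · rintro ⟨h1, h2, h3⟩
    refine ⟨by omega, ?_⟩
    rintro ⟨c, hc, htop, hlt, h⟩
    rw [mem_Ico] at hc
    have hcN : 1 ≤ c ∧ c ≤ N := by omega
    have hpc := pos_mem σ hcN
    rw [mem_descentTops σ hcN] at htop
    have hl := letter_mem σ (i := pos σ c + 1) (by omega)
    -- The letter after `c` is below `c`, hence below `x`, so the absence of small letters between
    -- `c` and `b` forces it to be `b`.
    have := h (letter σ (pos σ c + 1)) (mem_Ico.2 (by omega))
    rw [pos_letter σ (by omega)] at this
    have heq : pos σ b - 1 = pos σ c := by omega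
    rw [heq, letter_pos σ hcN] at h3
    omega
  · rintro ⟨⟨h1, h2⟩, h⟩
    refine ⟨by omega, hbx, ?_⟩
    by_contra hlt
    apply h
    have hl := letter_mem σ (i := pos σ b - 1) (by omega)
    refine ⟨letter σ (pos σ b - 1), mem_Ico.2 (by omega), ?_, ?_, ?_⟩
    · rw [mem_descentTops σ hl, pos_letter σ (by omega), Nat.sub_add_cancel (by omega),
        letter_pos σ hbN]
      exact ⟨hpb.2, h2⟩
    · rw [pos_letter σ (by omega)]
      omega
    · intro d hd
      rw [pos_letter σ (by omega)]
      omega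

/-- Indexing crossing descents by their bottoms expresses the count through letters below `x` only,
as the induction in `pos_lt_pos_congr` needs. -/
lemma card_openAt_le_pos {a x : ℕ} (hx : x ≤ N) :
    #{i ∈ openAt σ x | i ≤ pos σ a} =
      #{b ∈ Ico 1 x | pos σ b ∈ openAt σ x ∧ pos σ b ≤ pos σ a} := by
  refine card_nbij' (letter σ) (pos σ) ?_ ?_ ?_ ?_
  · intro i hi
    simp only [coe_filter, Set.mem_ofPred_eq, mem_Ico] at hi ⊢
    have h := (mem_openAt σ).1 hi.1
    rw [pos_letter σ (by omega)]
    exact ⟨⟨(letter_mem σ (by omega)).1, h.2.1⟩, hi⟩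
  · intro b hb
    simp only [coe_filter, Set.mem_ofPred_eq] at hb ⊢
    exact hb.2
  · intro i hi
    simp only [coe_filter, Set.mem_ofPred_eq] at hi
    have h := (mem_openAt σ).1 hi.1
    exact pos_letter σ (by omega)
  · intro b hb
    simp only [coe_filter, Set.mem_ofPred_eq, mem_Ico] at hb
    exact letter_pos σ (by omega)

variable {σ τ}

/-- Insert the letters in increasing order. The order and types of the letters below `x` determine
which descents cross `x`, and the left embracing number of `x` then tells which smaller letters
precede it. -/
lemma pos_lt_pos_congr (h : ∀ x, 1 ≤ x → x ≤ N → step σ x = step τ x) (x : ℕ) (hx : x ≤ N + 1) :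
    ∀ a b, 1 ≤ a → a < x → 1 ≤ b → b < x → (pos σ a < pos σ b ↔ pos τ a < pos τ b) := by
  have htop : ∀ y, 1 ≤ y → y ≤ N → (y ∈ descentTops σ ↔ y ∈ descentTops τ) := by
    intro y h1 h2
    simpa [step] using congrArg Prod.fst (h y h1 h2)
  have hbot : ∀ y, 1 ≤ y → y ≤ N → (y ∈ descentBottoms σ ↔ y ∈ descentBottoms τ) := by
    intro y h1 h2
    simpa [step] using congrArg (fun s => s.2.1) (h y h1 h2)
  have hl : ∀ y, 1 ≤ y → y ≤ N → leftEmb σ y = leftEmb τ y := by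
    intro y h1 h2
    exact congrArg (fun s => s.2.2) (h y h1 h2)
  induction x with
  | zero => intros; omega
  | succ x ih =>
    have ih := ih (by omega)
    have hle : ∀ a b, 1 ≤ a → a < x → 1 ≤ b → b < x →
        (pos σ a ≤ pos σ b ↔ pos τ a ≤ pos τ b) := by
      intro a b h1 h2 h3 h4
      rw [← not_lt, ih b a h3 h4 h1 h2, not_lt]
    have hopen : ∀ b, 1 ≤ b → b < x → (pos σ b ∈ openAt σ x ↔ pos τ b ∈ openAt τ x) := by
      intro b h1 h2
      rw [pos_mem_openAt_iff σ h1 h2 (by omega), pos_mem_openAt_iff τ h1 h2 (by omega),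
        hbot b h1 (by omega)]
      refine and_congr_right fun _ => not_congr (exists_congr fun c => and_congr_right fun hc => ?_)
      rw [mem_Ico] at hc
      rw [htop c hc.1 (by omega), ih c b hc.1 hc.2 h1 h2]
      refine and_congr_right fun _ => and_congr_right fun _ => forall_congr' fun d =>
        imp_congr_right fun hd => ?_
      rw [mem_Ico] at hd
      rw [ih c d hc.1 hc.2 hd.1 hd.2, ih d b hd.1 hd.2 h1 h2]
    have key : ∀ a, 1 ≤ a → a < x → (pos σ a < pos σ x ↔ pos τ a < pos τ x) := by
      intro a h1 h2
      rw [pos_lt_pos_iff σ h1 h2 (by omega), pos_lt_pos_iff τ h1 h2 (by omega),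
        card_openAt_le_pos σ (by omega), card_openAt_le_pos τ (by omega), hl x (by omega) (by omega)]
      have : {b ∈ Ico 1 x | pos σ b ∈ openAt σ x ∧ pos σ b ≤ pos σ a} =
          {b ∈ Ico 1 x | pos τ b ∈ openAt τ x ∧ pos τ b ≤ pos τ a} := by
        refine filter_congr fun b hb => ?_
        rw [mem_Ico] at hb
        rw [hopen b hb.1 hb.2, hle b a hb.1 hb.2 h1 h2]
      rw [this]
    intro a b h1 h2 h3 h4
    rcases Nat.lt_succ_iff_lt_or_eq.1 h2 with ha | rfl
    · rcases Nat.lt_succ_iff_lt_or_eq.1 h4 with hb | rfl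
      · exact ih a b h1 ha h3 hb
      · exact key a h1 ha
    · rcases Nat.lt_succ_iff_lt_or_eq.1 h4 with hb | rfl
      · have ne : ∀ ρ : Equiv.Perm (Fin N), pos ρ a ≠ pos ρ b := by
          intro ρ hρ
          have := letter_pos ρ (x := a) (by omega)
          rw [hρ, letter_pos ρ (by omega)] at this
          omega
        have h5 := key b h3 hb
        have h6 := ne σ
        have h7 := ne τ
        omega
      · simp

lemma eq_of_step_eq (h : ∀ x, 1 ≤ x → x ≤ N → step σ x = step τ x) : σ = τ := by
  have key := pos_lt_pos_congr h (N + 1) le_rfl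
  have hpos : ∀ (ρ : Equiv.Perm (Fin N)) (u : Fin N), pos ρ (u + 1) = (ρ⁻¹ u : ℕ) + 1 := by
    intro ρ u
    unfold pos letter
    rw [dif_pos (by omega)]
    simp
  have hlt : ∀ u v : Fin N, σ⁻¹ u < σ⁻¹ v ↔ τ⁻¹ u < τ⁻¹ v := by
    intro u v
    have := key (u + 1) (v + 1) (by omega) (by omega) (by omega) (by omega)
    rw [hpos, hpos, hpos, hpos] at this
    rw [Fin.lt_def, Fin.lt_def]
    omega
  -- Equal relative orders make `τ⁻¹ σ` an order automorphism of `Fin N`, and the identity is the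
  -- only one.
  have hmono : StrictMono (fun i => τ⁻¹ (σ i)) := by
    intro i j hij
    exact (hlt (σ i) (σ j)).1 (by simpa using hij)
  ext i
  let e : Fin N ≃o Fin N :=
    StrictMono.orderIsoOfSurjective _ hmono (τ⁻¹.surjective.comp σ.surjective)
  have he : e = OrderIso.refl (Fin N) := Subsingleton.elim _ _
  have : τ⁻¹ (σ i) = i := by
    have := congrArg (fun f : Fin N ≃o Fin N => f i) he
    simpa [e] using this
  rw [Equiv.Perm.inv_eq_iff_eq] at this
  rw [this]

lemma code_injective : Function.Injective (code (N := N)) := by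
  intro σ τ h
  refine eq_of_step_eq fun x h1 h2 => ?_
  unfold code at h
  rw [List.map_inj_left] at h
  exact h x (by simp [List.mem_range'_1]; omega)

end Code

/-! ### Histories -/

/-- The height after a step of a history. -/
def nextHeight (h : ℕ) (s : Bool × Bool × ℕ) : ℕ := h + s.2.1.toNat - s.1.toNat

/-- The steps that are possible at height `h`. -/
def steps (h : ℕ) : Finset (Bool × Bool × ℕ) :=
  {false} ×ˢ univ ×ˢ range (h + 1) ∪ {true} ×ˢ univ ×ˢ range h

/-- The histories with `n` steps from height `h` to height `0`. -/
def histories : ℕ → ℕ → Finset (List (Bool × Bool × ℕ))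
  | 0, h => if h = 0 then {[]} else ∅
  | n + 1, h => (steps h).biUnion fun s => (histories n (nextHeight h s)).image (List.cons s)

lemma mem_steps {h : ℕ} {s : Bool × Bool × ℕ} :
    s ∈ steps h ↔ s.2.2 + s.1.toNat ≤ h := by
  obtain ⟨a, b, l⟩ := s
  cases a <;> simp [steps]

lemma sum_steps {M : Type*} [AddCommMonoid M] (h : ℕ) (f : Bool × Bool × ℕ → M) :
    ∑ s ∈ steps h, f s =
      (∑ l ∈ range (h + 1), f (false, false, l) + ∑ l ∈ range (h + 1), f (false, true, l)) +
      (∑ l ∈ range h, f (true, false, l) + ∑ l ∈ range h, f (true, true, l)) := by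
  rw [steps, sum_union]
  · simp only [sum_product, sum_singleton, Fintype.sum_bool]
    rw [add_comm (∑ l ∈ range (h + 1), f (false, true, l)),
      add_comm (∑ l ∈ range h, f (true, true, l))]
  · rw [disjoint_left]
    rintro ⟨a, b, l⟩ h1 h2
    simp at h1 h2
    simp_all

lemma sum_histories_succ {M : Type*} [AddCommMonoid M] (n h : ℕ)
    (F : List (Bool × Bool × ℕ) → M) :
    ∑ L ∈ histories (n + 1) h, F L =
      ∑ s ∈ steps h, ∑ L ∈ histories n (nextHeight h s), F (s :: L) := by
  rw [histories, sum_biUnion]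
  · refine sum_congr rfl fun s _ => ?_
    rw [sum_image]
    simp
  · intro s _ s' _ hne
    rw [Function.onFun, disjoint_left]
    intro L h1 h2
    rw [mem_image] at h1 h2
    obtain ⟨L1, _, rfl⟩ := h1
    obtain ⟨L2, _, h⟩ := h2
    exact hne (List.cons.inj h).1.symm

/-- The general height is needed for the induction; only `h = 0`, where the count is `n!`, is used.
The four types of first step offer `h + 1`, `h + 1`, `h` and `h` choices of the embracing number. -/
lemma card_histories (n h : ℕ) : #(histories n h) = n.factorial * n.choose h := by
  induction n generalizing h with
  | zero =>
    rw [histories]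
    cases h <;> simp
  | succ n ih =>
    rw [card_eq_sum_ones, sum_histories_succ, sum_steps]
    simp only [ih, nextHeight, sum_const, card_range, Bool.toNat_true,
      Bool.toNat_false, smul_eq_mul]
    cases h with
    | zero =>
      simp [Nat.factorial_succ]
      ring
    | succ h =>
      have h1 := Nat.add_one_mul_choose_eq n (h + 1)
      have h2 := Nat.add_one_mul_choose_eq n h
      simp only [Nat.add_sub_cancel, Nat.sub_zero, add_zero]
      rw [Nat.factorial_succ]
      have h3 := Nat.choose_succ_succ n (h + 1)
      have h4 := Nat.choose_succ_succ n h
      simp only [Nat.succ_eq_add_one] at *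
      rw [h3] at h1
      rw [h4] at h2 ⊢
      zify at h1 h2 ⊢
      linear_combination (-n.factorial : ℤ) * h1 - n.factorial * h2

/-! ### Permutations as histories -/

section Code

variable {N : ℕ} (σ : Equiv.Perm (Fin N))

lemma height_succ_eq {x : ℕ} (hx : 1 ≤ x ∧ x ≤ N) :
    height σ (x + 1) = nextHeight (height σ x) (step σ x) := by
  have := height_succ σ hx
  unfold nextHeight step
  simp only
  split_ifs at this with h1 h2 h2 <;> simp [h1, h2] <;> omega

lemma step_mem_steps {x : ℕ} (hx : 1 ≤ x ∧ x ≤ N) : step σ x ∈ steps (height σ x) := by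
  have := leftEmb_add_rightEmb σ hx
  rw [mem_steps]
  unfold step
  split_ifs at this with h1 <;> simp [h1] <;> omega

lemma map_step_mem_histories (k x : ℕ) (hx : 1 ≤ x) (h : x + k = N + 1) :
    (List.range' x k).map (step σ) ∈ histories k (height σ x) := by
  induction k generalizing x with
  | zero =>
    obtain rfl : x = N + 1 := by omega
    simp [histories, height_last]
  | succ k ih =>
    rw [List.range'_succ, List.map_cons, histories, mem_biUnion]
    refine ⟨step σ x, step_mem_steps σ (by omega), mem_image_of_mem _ ?_⟩
    rw [← height_succ_eq σ (by omega)]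
    exact ih (x + 1) (by omega) (by omega)

lemma code_mem_histories : code σ ∈ histories N 0 := by
  rw [← height_one σ]
  exact map_step_mem_histories σ N 1 le_rfl (by omega)

/-- Surjectivity comes from counting: `code` is injective and both sides have `N!` elements, so no
inverse has to be constructed. -/
lemma image_code : univ.image (code (N := N)) = histories N 0 := by
  refine eq_of_subset_of_card_le (image_subset_iff.2 fun σ _ => code_mem_histories σ) ?_
  rw [card_image_of_injective _ code_injective, card_histories, card_univ, Fintype.card_perm]
  simp

/-- Permutations of `[N]` correspond to histories with `N` steps. -/
lemma sum_code {M : Type*} [AddCommMonoid M] (F : List (Bool × Bool × ℕ) → M) :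
    ∑ σ : Equiv.Perm (Fin N), F (code σ) = ∑ L ∈ histories N 0, F L := by
  rw [← image_code, sum_image fun _ _ _ _ h => code_injective h]

end Code

/-! ### Weighted histories and Motzkin paths -/

section Weights

variable {K : Type*} [Field K]

/-- The total weight of the Motzkin paths with `n` steps from height `h` to height `0`, where level
steps, up steps and down steps from height `h` have the weights `b h`, `u h` and `d h`. -/
def motzkin (b u d : ℕ → K) : ℕ → ℕ → K
  | 0, h => if h = 0 then 1 else 0
  | n + 1, h => b h * motzkin b u d n h + u h * motzkin b u d n (h + 1) +
      d h * motzkin b u d n (h - 1)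

/-- The product of the weights of the consecutive disjoint pairs of steps of a history. -/
def pairsWeight (w : ℕ → Bool × Bool × ℕ → Bool × Bool × ℕ → K) :
    ℕ → List (Bool × Bool × ℕ) → K
  | h, s₁ :: s₂ :: L => w h s₁ s₂ * pairsWeight w (nextHeight (nextHeight h s₁) s₂) L
  | _, _ => 1

/-- The hypothesis `hw` says that two consecutive steps, summed with their weights, act as one
Motzkin step on any function `X` of the final height. -/
lemma sum_pairsWeight (w : ℕ → Bool × Bool × ℕ → Bool × Bool × ℕ → K) (b u d : ℕ → K)
    (hw : ∀ (X : ℕ → K) (h : ℕ), ∑ s₁ ∈ steps h, ∑ s₂ ∈ steps (nextHeight h s₁),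
      w h s₁ s₂ * X (nextHeight (nextHeight h s₁) s₂) =
        b h * X h + u h * X (h + 1) + d h * X (h - 1)) (n h : ℕ) :
    ∑ L ∈ histories (2 * n) h, pairsWeight w h L = motzkin b u d n h := by
  induction n generalizing h with
  | zero =>
    rw [Nat.mul_zero, histories, motzkin]
    split_ifs <;> simp [pairsWeight]
  | succ n ih =>
    rw [show 2 * (n + 1) = 2 * n + 1 + 1 by ring, sum_histories_succ, motzkin, ← hw]
    refine sum_congr rfl fun s₁ _ => ?_
    rw [sum_histories_succ]
    refine sum_congr rfl fun s₂ _ => ?_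
    simp only [pairsWeight]
    rw [← mul_sum, ih]

/-- The condition on the steps of `2j - 1` and `2j`, starting from height `h`, in a normalized
E-permutation. -/
def NormalPair (h : ℕ) (s₁ s₂ : Bool × Bool × ℕ) : Prop :=
  s₁.1 = false ∧ s₂.2.1 = false ∧ ¬ (s₁.2.1 = true ∧ s₂.1 = true) ∧
  (s₁.2.1 = true → (Odd (h + 1) → Even s₂.2.2) ∧ (Even (h + 1) → Even s₁.2.2)) ∧
  (s₂.1 = true → (Odd h → Even (h - s₁.2.2)) ∧ (Even h → Even (h - 1 - s₂.2.2)))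

instance (h : ℕ) (s₁ s₂ : Bool × Bool × ℕ) : Decidable (NormalPair h s₁ s₂) := by
  unfold NormalPair; infer_instance

/-- The number of right embracings of a letter with the step `s` from height `h`. -/
def rightCount (h : ℕ) (s : Bool × Bool × ℕ) : ℕ := h - s.1.toNat - s.2.2

/-- The weight of the steps of `2j - 1` and `2j`, starting from height `h`. -/
def pairWeight (p q t : K) (h : ℕ) (s₁ s₂ : Bool × Bool × ℕ) : K :=
  if NormalPair h s₁ s₂ then
    p ^ (rightCount h s₁ + rightCount (nextHeight h s₁) s₂ - s₁.2.1.toNat) *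
      q ^ (s₁.2.2 + s₂.2.2 - s₂.1.toNat) * t ^ s₁.2.1.toNat
  else 0

lemma sum_range_two_mul {M : Type*} [AddCommMonoid M] (f : ℕ → M) (m : ℕ) :
    ∑ l ∈ range (2 * m), f l = ∑ i ∈ range m, (f (2 * i) + f (2 * i + 1)) := by
  induction m with
  | zero => simp
  | succ m ih =>
    rw [Nat.mul_succ, sum_range_succ, sum_range_succ, ih, sum_range_succ, add_assoc]

/-- The terms of `[2m]` are taken in adjacent pairs, each a multiple of `p + q`. Here the quotient
is indexed by the even member of the pair, with one factor `p` removed; in `add_mul_sum_odd` by the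
odd member, with one factor `q` removed. -/
lemma add_mul_sum_even (p q : K) (m : ℕ) :
    (p + q) * ∑ l ∈ range (2 * m), (if Even l then p ^ (2 * m - 1 - l - 1) * q ^ l else 0) =
      pqNat p q (2 * m) := by
  rw [pqNat, sum_range_two_mul, sum_range_two_mul, mul_sum]
  refine sum_congr rfl fun i hi => ?_
  rw [mem_range] at hi
  rw [if_pos (by simp), if_neg (by simp)]
  obtain ⟨k, rfl⟩ : ∃ k, m = i + 1 + k := ⟨m - (i + 1), by omega⟩
  rw [show 2 * (i + 1 + k) - 1 - 2 * i - 1 = 2 * k by omega,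
    show 2 * (i + 1 + k) - 1 - 2 * i = 2 * k + 1 by omega,
    show 2 * (i + 1 + k) - 1 - (2 * i + 1) = 2 * k by omega]
  ring

lemma add_mul_sum_odd (p q : K) (m : ℕ) :
    (p + q) * ∑ l ∈ range (2 * m),
      (if Even (2 * m - 1 - l) then p ^ (2 * m - 1 - l) * q ^ (l - 1) else 0) =
      pqNat p q (2 * m) := by
  rw [pqNat, sum_range_two_mul, sum_range_two_mul, mul_sum]
  refine sum_congr rfl fun i hi => ?_
  rw [mem_range] at hi
  obtain ⟨k, rfl⟩ : ∃ k, m = i + 1 + k := ⟨m - (i + 1), by omega⟩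
  rw [show 2 * (i + 1 + k) - 1 - 2 * i = 2 * k + 1 by omega,
    show 2 * (i + 1 + k) - 1 - (2 * i + 1) = 2 * k by omega, if_neg (by simp), if_pos (by simp)]
  simp only [Nat.add_sub_cancel]
  ring

lemma sum_level (p q : K) (h : ℕ) :
    ∑ l₁ ∈ range (h + 1), ∑ l₂ ∈ range (h + 1), p ^ (h - l₁ + (h - l₂)) * q ^ (l₁ + l₂) =
      pqNat p q (h + 1) ^ 2 := by
  rw [sq, pqNat, sum_mul_sum]
  refine sum_congr rfl fun _ _ => sum_congr rfl fun _ _ => ?_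
  rw [Nat.add_sub_cancel]
  ring

/-- Exactly one of the ranges has even length, and the parity condition restricts that one. The
other range contributes its full `[·]`, while `add_mul_sum_even` evaluates the restricted one. In
`sum_down` the lengths are `h + 1` and `h`, and `add_mul_sum_odd` is used. -/
lemma sum_up (p q : K) (hpq : p + q ≠ 0) (h : ℕ) :
    ∑ l₁ ∈ range (h + 1), ∑ l₂ ∈ range (h + 2),
      (if (Odd (h + 1) → Even l₂) ∧ (Even (h + 1) → Even l₁) then
        p ^ (h - l₁ + (h + 1 - l₂) - 1) * q ^ (l₁ + l₂) else 0) =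
      pqNat p q (h + 1) * pqNat p q (h + 2) / (p + q) := by
  rw [eq_div_iff hpq, mul_comm]
  rcases Nat.even_or_odd (h + 1) with he | ho
  · obtain ⟨m, hm⟩ := even_iff_exists_two_mul.1 he
    conv_rhs => rw [hm, ← add_mul_sum_even, pqNat]
    rw [mul_assoc, sum_mul_sum, hm]
    congr 1
    refine sum_congr rfl fun l₁ h₁ => sum_congr rfl fun l₂ h₂ => ?_
    rw [mem_range] at h₁ h₂
    by_cases hl : Even l₁
    · rw [if_pos ⟨fun h => absurd h (by simp), fun _ => hl⟩, if_pos hl]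
      have : 2 * m - 1 - l₁ ≠ 0 := by
        obtain ⟨k, rfl⟩ := hl
        omega
      rw [show h - l₁ + (2 * m - l₂) - 1 = (2 * m - 1 - l₁ - 1) + (2 * m - l₂) by omega,
        show h + 2 - 1 - l₂ = 2 * m - l₂ by omega]
      ring
    · rw [if_neg fun h => hl (h.2 (by simp)), if_neg hl, zero_mul]
  · obtain ⟨m, hm⟩ : ∃ m, h + 2 = 2 * m := even_iff_exists_two_mul.1 ho.add_one
    conv_rhs => rw [hm, ← add_mul_sum_even, pqNat, mul_left_comm]
    rw [sum_mul_sum, hm]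
    congr 1
    refine sum_congr rfl fun l₁ h₁ => sum_congr rfl fun l₂ h₂ => ?_
    rw [mem_range] at h₁ h₂
    by_cases hl : Even l₂
    · rw [if_pos ⟨fun _ => hl, fun h => absurd h (Nat.not_even_iff_odd.2 ho)⟩, if_pos hl]
      have : 2 * m - 1 - l₂ ≠ 0 := by
        obtain ⟨k, rfl⟩ := hl
        omega
      rw [show h - l₁ + (h + 1 - l₂) - 1 = (h - l₁) + (2 * m - 1 - l₂ - 1) by omega,
        Nat.add_sub_cancel]
      ring
    · rw [if_neg fun h => hl (h.1 ho), if_neg hl, mul_zero]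

lemma sum_down (p q : K) (hpq : p + q ≠ 0) (h : ℕ) :
    ∑ l₁ ∈ range (h + 1), ∑ l₂ ∈ range h,
      (if (Odd h → Even (h - l₁)) ∧ (Even h → Even (h - 1 - l₂)) then
        p ^ (h - l₁ + (h - 1 - l₂)) * q ^ (l₁ + l₂ - 1) else 0) =
      pqNat p q (h + 1) * pqNat p q h / (p + q) := by
  rw [eq_div_iff hpq, mul_comm]
  rcases Nat.even_or_odd h with he | ho
  · obtain ⟨m, hm⟩ := even_iff_exists_two_mul.1 he
    conv_rhs => rw [hm, ← add_mul_sum_odd, pqNat, mul_left_comm]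
    rw [sum_mul_sum, hm]
    congr 1
    refine sum_congr rfl fun l₁ h₁ => sum_congr rfl fun l₂ h₂ => ?_
    rw [mem_range] at h₁ h₂
    by_cases hl : Even (2 * m - 1 - l₂)
    · rw [if_pos ⟨fun h => absurd h (by simp), fun _ => hl⟩, if_pos hl]
      have : l₂ ≠ 0 := by
        rintro rfl
        obtain ⟨k, hk⟩ := hl
        omega
      rw [show l₁ + l₂ - 1 = l₁ + (l₂ - 1) by omega, Nat.add_sub_cancel]
      ring
    · rw [if_neg fun h => hl (h.2 (by simp)), if_neg hl, mul_zero]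
  · obtain ⟨m, hm⟩ : ∃ m, h + 1 = 2 * m := even_iff_exists_two_mul.1 ho.add_one
    conv_rhs => rw [hm, ← add_mul_sum_odd, pqNat]
    rw [mul_assoc, sum_mul_sum, hm]
    congr 1
    refine sum_congr rfl fun l₁ h₁ => sum_congr rfl fun l₂ h₂ => ?_
    rw [mem_range] at h₁ h₂
    have hh : h = 2 * m - 1 := by omega
    by_cases hl : Even (2 * m - 1 - l₁)
    · rw [if_pos ⟨fun _ => by rwa [hh], fun h => absurd h (Nat.not_even_iff_odd.2 ho)⟩, if_pos hl]
      have : l₁ ≠ 0 := by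
        rintro rfl
        obtain ⟨k, hk⟩ := hl
        omega
      rw [show l₁ + l₂ - 1 = (l₁ - 1) + l₂ by omega, ← hh]
      ring
    · rw [if_neg fun h' => hl (by rw [← hh]; exact h'.1 ho), if_neg hl, zero_mul]

/-- Of the sixteen combinations of types, `NormalPair` leaves three: the level, up and down steps.
The truncated `h - 1` is harmless at `h = 0`, where the factor `pqNat p q 0` vanishes. -/
lemma sum_pairWeight (p q t : K) (hpq : p + q ≠ 0) (X : ℕ → K) (h : ℕ) :
    ∑ s₁ ∈ steps h, ∑ s₂ ∈ steps (nextHeight h s₁),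
      pairWeight p q t h s₁ s₂ * X (nextHeight (nextHeight h s₁) s₂) =
        pqNat p q (h + 1) ^ 2 * X h +
        pqNat p q (h + 1) * pqNat p q (h + 2) / (p + q) * t * X (h + 1) +
        pqNat p q (h + 1) * pqNat p q h / (p + q) * X (h - 1) := by
  rw [← sum_level, ← sum_up p q hpq, ← sum_down p q hpq]
  simp only [sum_steps, pairWeight, NormalPair, nextHeight, rightCount, Bool.toNat_true,
    Bool.toNat_false, reduceCtorEq, false_and, and_false, if_false, zero_mul, sum_const_zero,
    add_zero, Nat.sub_zero, true_and, not_false_eq_true, and_true, and_self, if_true,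
    not_true_eq_false, pow_zero, mul_one, pow_one, false_implies, forall_const, sum_mul,
    sum_add_distrib, ite_mul]

end Weights

/-! ### The weight of a permutation -/

section Perm

lemma isEPerm_iff {n : ℕ} (σ : Equiv.Perm (Fin (2 * n))) :
    IsEPerm σ ↔ ∀ i ∈ range n, 2 * i + 1 ∉ descentTops σ ∧ 2 * i + 2 ∉ descentBottoms σ ∧
      ¬ (2 * i + 1 ∈ descentBottoms σ ∧ 2 * i + 2 ∈ descentTops σ) := by
  have h1 : IsEvenOdd σ ↔ (∀ x ∈ descentTops σ, Even x) ∧ ∀ x ∈ descentBottoms σ, Odd x := by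
    simp only [IsEvenOdd, descentTops, descentBottoms, forall_mem_image, mem_filter]
    exact ⟨fun h => ⟨fun i hi => (h i hi.1 hi.2).1, fun i hi => (h i hi.1 hi.2).2⟩,
      fun h i hi hd => ⟨h.1 ⟨hi, hd⟩, h.2 ⟨hi, hd⟩⟩⟩
  rw [IsEPerm, h1]
  constructor
  · rintro ⟨⟨ht, hb⟩, h⟩ i hi
    rw [mem_range] at hi
    refine ⟨fun h => ?_, fun h => ?_, ?_⟩
    · obtain ⟨k, hk⟩ := ht _ h
      omega
    · obtain ⟨k, hk⟩ := hb _ h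
      omega
    · exact h (i + 1) (mem_Icc.2 (by omega))
  · intro h
    refine ⟨⟨fun x hx => ?_, fun x hx => ?_⟩, fun j hj => ?_⟩
    · have hr := mem_range_of_mem_descentTops σ hx
      by_contra ho
      obtain ⟨k, rfl⟩ := Nat.not_even_iff_odd.1 ho
      exact (h k (mem_range.2 (by omega))).1 hx
    · have hr := mem_range_of_mem_descentBottoms σ hx
      by_contra ho
      obtain ⟨k, rfl⟩ := even_iff_exists_two_mul.1 (Nat.not_odd_iff_even.1 ho)
      obtain ⟨i, rfl⟩ : ∃ i, k = i + 1 := ⟨k - 1, by omega⟩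
      exact (h i (mem_range.2 (by omega))).2.1 hx
    · rw [mem_Icc] at hj
      obtain ⟨i, rfl⟩ : ∃ i, j = i + 1 := ⟨j - 1, by omega⟩
      exact (h i (mem_range.2 (by omega))).2.2

lemma IsEPerm.even_of_mem_descentTops {n : ℕ} {σ : Equiv.Perm (Fin (2 * n))} (h : IsEPerm σ)
    {x : ℕ} (hx : x ∈ descentTops σ) : Even x := by
  simp only [descentTops, mem_image, mem_filter] at hx
  obtain ⟨i, ⟨hi, hd⟩, rfl⟩ := hx
  exact (h.1 i hi hd).1

lemma IsEPerm.odd_of_mem_descentBottoms {n : ℕ} {σ : Equiv.Perm (Fin (2 * n))} (h : IsEPerm σ)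
    {x : ℕ} (hx : x ∈ descentBottoms σ) : Odd x := by
  simp only [descentBottoms, mem_image, mem_filter] at hx
  obtain ⟨i, ⟨hi, hd⟩, rfl⟩ := hx
  exact (h.1 i hi hd).2

/-- The signature function of an E-permutation in terms of the number of crossing descents. -/
lemma IsEPerm.sigFun_eq {n : ℕ} {σ : Equiv.Perm (Fin (2 * n))} (h : IsEPerm σ) {x : ℕ}
    (hx : 1 ≤ x) (hn : x ≤ 2 * n) :
    sigFun (signature σ) x = height σ x + if x ∈ descentTops σ then 0 else 1 := by
  have key := height_add_card_tops σ hx (by omega)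
  have ho : {y ∈ signature σ | Odd y ∧ y < x} = {y ∈ descentBottoms σ | y < x} := by
    ext y
    simp only [signature, mem_filter, mem_union]
    constructor
    · rintro ⟨hy | hy, h1, h2⟩
      · exact absurd h1 (Nat.not_odd_iff_even.2 (h.even_of_mem_descentTops hy))
      · exact ⟨hy, h2⟩
    · rintro ⟨hy, h2⟩
      exact ⟨Or.inr hy, h.odd_of_mem_descentBottoms hy, h2⟩
  have he : {y ∈ signature σ | Even y ∧ y < x} = {y ∈ descentTops σ | y < x} := by
    ext y
    simp only [signature, mem_filter, mem_union]
    constructor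
    · rintro ⟨hy | hy, h1, h2⟩
      · exact ⟨hy, h2⟩
      · exact absurd h1 (Nat.not_even_iff_odd.2 (h.odd_of_mem_descentBottoms hy))
    · rintro ⟨hy, h2⟩
      exact ⟨Or.inl hy, h.even_of_mem_descentTops hy, h2⟩
  have hif : ((x ∈ signature σ ∧ Odd x) ∨ x ∉ signature σ) ↔ x ∉ descentTops σ := by
    simp only [signature, mem_union]
    constructor
    · rintro (⟨-, h1⟩ | h1) hx
      · exact absurd h1 (Nat.not_odd_iff_even.2 (h.even_of_mem_descentTops hx))
      · exact h1 (Or.inl hx)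
    · intro hx
      by_cases hb : x ∈ descentBottoms σ
      · exact Or.inl ⟨Or.inr hb, h.odd_of_mem_descentBottoms hb⟩
      · exact Or.inr (by tauto)
  unfold sigFun
  rw [ho, he]
  simp only [hif, ite_not]
  omega

variable {N : ℕ} (σ : Equiv.Perm (Fin N))

lemma rightEmb_eq_rightCount {x : ℕ} (hx : 1 ≤ x ∧ x ≤ N) :
    rightEmb σ x = rightCount (height σ x) (step σ x) := by
  have := leftEmb_add_rightEmb σ hx
  unfold rightCount step
  split_ifs at this with h <;> simp [h] <;> omega

lemma pairsWeight_map_step {K : Type*} [Field K]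
    (w : ℕ → Bool × Bool × ℕ → Bool × Bool × ℕ → K) (k j : ℕ) (h : 2 * (j + k) ≤ N) :
    pairsWeight w (height σ (2 * j + 1)) ((List.range' (2 * j + 1) (2 * k)).map (step σ)) =
      ∏ i ∈ range k, w (height σ (2 * (j + i) + 1)) (step σ (2 * (j + i) + 1))
        (step σ (2 * (j + i) + 2)) := by
  induction k generalizing j with
  | zero => simp [pairsWeight]
  | succ k ih =>
    rw [show 2 * (k + 1) = 2 * k + 1 + 1 by ring, List.range'_succ, List.range'_succ,
      List.map_cons, List.map_cons, pairsWeight, ← height_succ_eq σ (by omega),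
      ← height_succ_eq σ (by omega), prod_range_succ', mul_comm]
    congr 1
    rw [show 2 * j + 1 + 1 + 1 = 2 * (j + 1) + 1 by ring, ih (j + 1) (by omega)]
    refine prod_congr rfl fun i _ => ?_
    rw [show j + 1 + i = j + (i + 1) by ring]

end Perm

/-! ### Normalization as a condition on pairs of letters, and additivity of the statistics -/

section Normalized

variable {n : ℕ} (σ : Equiv.Perm (Fin (2 * n)))

lemma normalPair_iff (h : IsEPerm σ) {i : ℕ} (hi : i < n) :
    NormalPair (height σ (2 * i + 1)) (step σ (2 * i + 1)) (step σ (2 * i + 2)) ↔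
      ((2 * (i + 1) - 1 ∈ signature σ → Odd (sigFun (signature σ) (2 * (i + 1) - 1)) →
        Even (leftEmb σ (2 * (i + 1)))) ∧
      (2 * (i + 1) - 1 ∈ signature σ → Even (sigFun (signature σ) (2 * (i + 1) - 1)) →
        Even (leftEmb σ (2 * (i + 1) - 1))) ∧
      (2 * (i + 1) ∈ signature σ → Odd (sigFun (signature σ) (2 * (i + 1))) →
        Even (rightEmb σ (2 * (i + 1) - 1))) ∧
      (2 * (i + 1) ∈ signature σ → Even (sigFun (signature σ) (2 * (i + 1))) →
        Even (rightEmb σ (2 * (i + 1))))) := by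
  obtain ⟨ht, hb, htb⟩ := (isEPerm_iff σ).1 h i (mem_range.2 hi)
  have hh := height_succ σ (x := 2 * i + 1) (by omega)
  rw [if_neg ht] at hh
  have hs1 : 2 * i + 1 ∈ signature σ ↔ 2 * i + 1 ∈ descentBottoms σ := by
    simp [signature, ht]
  have hs2 : 2 * i + 2 ∈ signature σ ↔ 2 * i + 2 ∈ descentTops σ := by
    simp [signature, hb]
  rw [show 2 * (i + 1) - 1 = 2 * i + 1 by omega, show 2 * (i + 1) = 2 * i + 2 by ring, hs1, hs2,
    h.sigFun_eq (by omega) (by omega), h.sigFun_eq (by omega) (by omega), if_neg ht,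
    rightEmb_eq_rightCount σ (by omega), rightEmb_eq_rightCount σ (by omega), NormalPair,
    rightCount, rightCount]
  simp only [step, ht, hb, htb, decide_false, decide_eq_true_eq, not_false_eq_true, true_and,
    Bool.toNat_false, Nat.sub_zero]
  rw [← and_assoc]
  refine and_congr ?_ ?_
  · norm_cast
    tauto
  · rw [imp_and]
    refine and_congr (imp_congr_right fun h2 => ?_) (imp_congr_right fun h2 => ?_)
    -- If `2i + 2` is a top, then `2i + 1` is not a bottom, so the height is the same at both
    -- letters and the signature function at `2i + 2` equals it.
    · rw [if_neg (by tauto)] at hh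
      replace hh : height σ (2 * i + 2) = height σ (2 * i + 1) := hh
      simp only [h2, if_true, hh, add_zero]
      norm_cast
    · rw [if_neg (by tauto)] at hh
      replace hh : height σ (2 * i + 2) = height σ (2 * i + 1) := hh
      simp only [h2, if_true, hh, decide_true, Bool.toNat_true, add_zero]
      norm_cast

lemma isNormalized_iff :
    IsNormalized σ ↔ ∀ i ∈ range n,
      NormalPair (height σ (2 * i + 1)) (step σ (2 * i + 1)) (step σ (2 * i + 2)) := by
  constructor
  · rintro ⟨he, h⟩ i hi
    rw [mem_range] at hi
    exact (normalPair_iff σ he hi).2 (h (i + 1) (mem_Icc.2 (by omega)))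
  · intro h
    have he : IsEPerm σ := by
      refine (isEPerm_iff σ).2 fun i hi => ?_
      have := h i hi
      simp only [NormalPair, step, decide_eq_false_iff_not, decide_eq_true_eq] at this
      exact ⟨this.1, this.2.1, this.2.2.1⟩
    refine ⟨he, fun j hj => ?_⟩
    rw [mem_Icc] at hj
    obtain ⟨i, rfl⟩ : ∃ i, j = i + 1 := ⟨j - 1, by omega⟩
    exact (normalPair_iff σ he (by omega)).1 (h i (mem_range.2 (by omega)))

/-- Each descent bottom of a normalized E-permutation contributes to a right embracing. -/
lemma NormalPair.le_rightCount {h : ℕ} {s₁ s₂ : Bool × Bool × ℕ} (hn : NormalPair h s₁ s₂)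
    (h1 : s₁ ∈ steps h) (h2 : s₂ ∈ steps (nextHeight h s₁)) :
    s₁.2.1.toNat ≤ rightCount h s₁ + rightCount (nextHeight h s₁) s₂ := by
  obtain ⟨a, b, l⟩ := s₁
  obtain ⟨a', b', l'⟩ := s₂
  rw [mem_steps] at h1 h2
  cases b
  · simp
  · obtain ⟨rfl, rfl, h3, h4, -⟩ := hn
    simp only [Bool.not_eq_true, true_and] at h3
    subst h3
    simp only [nextHeight, rightCount, Bool.toNat_true, Bool.toNat_false] at *
    replace h4 := h4 trivial
    -- With no right embracing at all, the left embracing numbers would be `h` and `h + 1`; the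
    -- parity condition requires the odd one of these to be even.
    rcases Nat.even_or_odd (h + 1) with he | ho
    · obtain ⟨k, hk⟩ := he
      obtain ⟨m, hm⟩ := h4.2 ⟨k, hk⟩
      omega
    · obtain ⟨m, hm⟩ := h4.1 ho
      obtain ⟨k, hk⟩ := ho
      omega

/-- Each descent top of a normalized E-permutation contributes to a left embracing. -/
lemma NormalPair.le_left {h : ℕ} {s₁ s₂ : Bool × Bool × ℕ} (hn : NormalPair h s₁ s₂)
    (h1 : s₁ ∈ steps h) (h2 : s₂ ∈ steps (nextHeight h s₁)) :
    s₂.1.toNat ≤ s₁.2.2 + s₂.2.2 := by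
  obtain ⟨a, b, l⟩ := s₁
  obtain ⟨a', b', l'⟩ := s₂
  rw [mem_steps] at h1 h2
  cases a'
  · simp
  · obtain ⟨rfl, rfl, h3, -, h4⟩ := hn
    simp only [and_true, Bool.not_eq_true] at h3
    subst h3
    simp only [nextHeight, Bool.toNat_true, Bool.toNat_false] at *
    replace h4 := h4 trivial
    -- With no left embracing at all, the right embracing numbers would be `h` and `h - 1`; the
    -- parity condition requires the odd one of these to be even.
    rcases Nat.even_or_odd h with he | ho
    · obtain ⟨m, hm⟩ := h4.2 he
      obtain ⟨k, hk⟩ := he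
      omega
    · obtain ⟨m, hm⟩ := h4.1 ho
      obtain ⟨k, hk⟩ := ho
      omega

lemma sum_Icc_two_mul {M : Type*} [AddCommMonoid M] (f : ℕ → M) (n : ℕ) :
    ∑ x ∈ Icc 1 (2 * n), f x = ∑ i ∈ range n, (f (2 * i + 1) + f (2 * i + 2)) := by
  rw [← sum_range_two_mul (fun l => f (l + 1)), range_eq_Ico, sum_Ico_add' f 0 (2 * n) 1]
  rfl

lemma les_eq_sum_pairs :
    les σ = ∑ i ∈ range n, ((step σ (2 * i + 1)).2.2 + (step σ (2 * i + 2)).2.2) := by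
  rw [les_eq_sum, sum_Icc_two_mul]
  rfl

lemma res_eq_sum_pairs :
    res σ = ∑ i ∈ range n, (rightCount (height σ (2 * i + 1)) (step σ (2 * i + 1)) +
      rightCount (nextHeight (height σ (2 * i + 1)) (step σ (2 * i + 1))) (step σ (2 * i + 2))) := by
  rw [res_eq_sum, sum_Icc_two_mul]
  refine sum_congr rfl fun i hi => ?_
  rw [mem_range] at hi
  rw [← height_succ_eq σ (by omega), rightEmb_eq_rightCount σ (by omega),
    rightEmb_eq_rightCount σ (by omega)]

variable {σ}

lemma IsEPerm.des_eq_sum_bottoms (h : IsEPerm σ) :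
    des σ = ∑ i ∈ range n, (step σ (2 * i + 1)).2.1.toNat := by
  rw [des_eq_sum, sum_Icc_two_mul]
  refine sum_congr rfl fun i hi => ?_
  rw [if_neg ((isEPerm_iff σ).1 h i hi).2.1, step]
  split_ifs with hb <;> simp [hb]

lemma IsEPerm.des_eq_sum_tops (h : IsEPerm σ) :
    des σ = ∑ i ∈ range n, (step σ (2 * i + 2)).1.toNat := by
  have hsum : des σ = ∑ x ∈ Icc 1 (2 * n), if x ∈ descentTops σ then 1 else 0 := by
    have := height_add_card_tops σ (x := 2 * n + 1) (by omega) le_rfl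
    rw [height_last, zero_add, filter_true_of_mem fun y hy =>
      Nat.lt_succ_of_le (mem_range_of_mem_descentBottoms σ hy).2, filter_true_of_mem fun y hy =>
      Nat.lt_succ_of_le (mem_range_of_mem_descentTops σ hy).2] at this
    rw [← card_descentBottoms, ← this, ← card_filter]
    congr 1
    ext x
    simp only [mem_filter, mem_Icc]
    exact ⟨fun h => ⟨mem_range_of_mem_descentTops σ h, h⟩, fun h => h.2⟩
  rw [hsum, sum_Icc_two_mul]
  refine sum_congr rfl fun i hi => ?_
  rw [if_neg ((isEPerm_iff σ).1 h i hi).1, step]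
  split_ifs with hb <;> simp [hb]

lemma IsNormalized.bottoms_le (h : IsNormalized σ) {i : ℕ} (hi : i ∈ range n) :
    (step σ (2 * i + 1)).2.1.toNat ≤ rightCount (height σ (2 * i + 1)) (step σ (2 * i + 1)) +
      rightCount (nextHeight (height σ (2 * i + 1)) (step σ (2 * i + 1))) (step σ (2 * i + 2)) := by
  have hn := (isNormalized_iff σ).1 h i hi
  rw [mem_range] at hi
  refine hn.le_rightCount (step_mem_steps σ (by omega)) ?_
  rw [← height_succ_eq σ (by omega)]
  exact step_mem_steps σ (by omega)

lemma IsNormalized.tops_le (h : IsNormalized σ) {i : ℕ} (hi : i ∈ range n) :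
    (step σ (2 * i + 2)).1.toNat ≤ (step σ (2 * i + 1)).2.2 + (step σ (2 * i + 2)).2.2 := by
  have hn := (isNormalized_iff σ).1 h i hi
  rw [mem_range] at hi
  refine hn.le_left (step_mem_steps σ (by omega)) ?_
  rw [← height_succ_eq σ (by omega)]
  exact step_mem_steps σ (by omega)

lemma IsNormalized.des_le_res (h : IsNormalized σ) : des σ ≤ res σ := by
  rw [h.1.des_eq_sum_bottoms, res_eq_sum_pairs]
  exact sum_le_sum fun i hi => h.bottoms_le hi

lemma IsNormalized.des_le_les (h : IsNormalized σ) : des σ ≤ les σ := by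
  rw [h.1.des_eq_sum_tops, les_eq_sum_pairs]
  exact sum_le_sum fun i hi => h.tops_le hi

variable (σ) in
lemma pairsWeight_code {K : Type*} [Field K] (p q t : K) :
    pairsWeight (pairWeight p q t) 0 (code σ) =
      if IsNormalized σ then p ^ (res σ - des σ) * q ^ (les σ - des σ) * t ^ des σ else 0 := by
  have := pairsWeight_map_step σ (pairWeight p q t) n 0 (by omega)
  simp only [Nat.mul_zero, zero_add, height_one] at this
  rw [code, this]
  split_ifs with h
  -- Truncated subtraction distributes over the pairs because the inequality holds in each pair.
  -- Descents are charged to their bottoms in the exponent of `p` and to their tops in that of `q`.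
  · have hr : res σ - des σ = ∑ i ∈ range n,
        (rightCount (height σ (2 * i + 1)) (step σ (2 * i + 1)) +
        rightCount (nextHeight (height σ (2 * i + 1)) (step σ (2 * i + 1))) (step σ (2 * i + 2)) -
        (step σ (2 * i + 1)).2.1.toNat) := by
      rw [sum_tsub_distrib _ fun i hi => h.bottoms_le hi, ← h.1.des_eq_sum_bottoms,
        ← res_eq_sum_pairs]
    have hl : les σ - des σ = ∑ i ∈ range n,
        ((step σ (2 * i + 1)).2.2 + (step σ (2 * i + 2)).2.2 - (step σ (2 * i + 2)).1.toNat) := by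
      rw [sum_tsub_distrib _ fun i hi => h.tops_le hi, ← h.1.des_eq_sum_tops, ← les_eq_sum_pairs]
    rw [hr, hl, h.1.des_eq_sum_bottoms, ← prod_pow_eq_pow_sum, ← prod_pow_eq_pow_sum,
      ← prod_pow_eq_pow_sum, ← prod_mul_distrib, ← prod_mul_distrib]
    exact prod_congr rfl fun i hi => if_pos ((isNormalized_iff σ).1 h i hi)
  · rw [isNormalized_iff] at h
    push Not at h
    obtain ⟨i, hi, hn⟩ := h
    exact prod_eq_zero hi (if_neg hn)

end Normalized

/-- The generating polynomial of the normalized E-permutations as a sum over Motzkin paths. -/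
lemma sum_normalizedEPerms {K : Type*} [Field K] (p q t : K) (hpq : p + q ≠ 0) (n : ℕ) :
    ∑ σ ∈ normalizedEPerms n, p ^ (res σ - des σ) * q ^ (les σ - des σ) * t ^ des σ =
      motzkin (fun h => pqNat p q (h + 1) ^ 2)
        (fun h => pqNat p q (h + 1) * pqNat p q (h + 2) / (p + q) * t)
        (fun h => pqNat p q (h + 1) * pqNat p q h / (p + q)) n 0 := by
  rw [← sum_pairsWeight (pairWeight p q t) _ _ _ (sum_pairWeight p q t hpq), ← sum_code,
    normalizedEPerms, sum_filter]
  exact sum_congr rfl fun σ _ => (pairsWeight_code σ p q t).symm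

/-! ### Motzkin paths and J-fractions -/

section JFraction

open PowerSeries

variable {K : Type*} [Field K]

/-- The generating function of the Motzkin paths from height `h` to height `0`. -/
noncomputable def motzkinSeries (b u d : ℕ → K) (h : ℕ) : PowerSeries K :=
  PowerSeries.mk fun n => motzkin b u d n h

lemma motzkinSeries_eq (b u d : ℕ → K) (h : ℕ) :
    motzkinSeries b u d h = (if h = 0 then 1 else 0) +
      X * (C (b h) * motzkinSeries b u d h + C (u h) * motzkinSeries b u d (h + 1) +
        C (d h) * motzkinSeries b u d (h - 1)) := by
  ext n
  cases n with
  | zero => split_ifs with h0 <;> simp [motzkinSeries, motzkin, h0]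
  | succ n =>
    rw [map_add, coeff_succ_X_mul]
    split_ifs <;> simp [motzkinSeries, motzkin, coeff_one]

lemma jConvergent_succ_mul (b lam : ℕ → K) (m k : ℕ) :
    jConvergent b lam (m + 1) k *
      (1 - C (b k) * X - C (lam (k + 1)) * X ^ 2 * jConvergent b lam m (k + 1)) = 1 := by
  rw [jConvergent, mul_comm]
  exact PowerSeries.mul_inv_cancel _ (by simp)

/-- The ratio of Motzkin series at successive heights is a tail of the continued fraction, up to the
factor `d X`. The first-step equation at height `h + 1` multiplies the next series by `X`, so each
further level gains one order of precision. -/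
lemma motzkinSeries_succ_congr (b u d lam : ℕ → K) (hlam : ∀ h, lam (h + 1) = u h * d (h + 1))
    (m h : ℕ) :
    X ^ m ∣ motzkinSeries b u d (h + 1) -
      C (d (h + 1)) * X * jConvergent b lam m (h + 1) * motzkinSeries b u d h := by
  induction m generalizing h with
  | zero => simp
  | succ m ih =>
    obtain ⟨e, he⟩ := ih (h + 1)
    have hG := motzkinSeries_eq b u d (h + 1)
    have hJ := jConvergent_succ_mul b lam m (h + 1)
    rw [if_neg (by omega), Nat.add_sub_cancel] at hG
    rw [hlam, map_mul] at hJ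
    refine ⟨jConvergent b lam (m + 1) (h + 1) * C (u (h + 1)) * e, ?_⟩
    linear_combination (-motzkinSeries b u d (h + 1)) * hJ +
      jConvergent b lam (m + 1) (h + 1) * hG +
      jConvergent b lam (m + 1) (h + 1) * C (u (h + 1)) * X * he

lemma hasJFraction_motzkin (b u d lam : ℕ → K) (hlam : ∀ h, lam (h + 1) = u h * d (h + 1))
    (hd : d 0 = 0) : HasJFraction (PowerSeries.mk fun n => motzkin b u d n 0) b lam := by
  intro n
  filter_upwards [Filter.eventually_gt_atTop n] with m hm
  obtain ⟨m, rfl⟩ : ∃ k, m = k + 1 := ⟨m - 1, by omega⟩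
  have hdvd : X ^ (m + 1) ∣ jConvergent b lam (m + 1) 0 - motzkinSeries b u d 0 := by
    obtain ⟨e, he⟩ := motzkinSeries_succ_congr b u d lam hlam m 0
    have hG := motzkinSeries_eq b u d 0
    have hJ := jConvergent_succ_mul b lam m 0
    rw [if_pos rfl, hd, map_zero, zero_mul, add_zero] at hG
    rw [hlam, map_mul] at hJ
    refine ⟨-jConvergent b lam (m + 1) 0 * C (u 0) * e, ?_⟩
    linear_combination motzkinSeries b u d 0 * hJ - jConvergent b lam (m + 1) 0 * hG -
      jConvergent b lam (m + 1) 0 * C (u 0) * X * he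
  have := (X_pow_dvd_iff.1 hdvd) n hm
  rw [map_sub, sub_eq_zero] at this
  exact this

end JFraction

/-! ### Median Genocchi numbers -/

section Genocchi

open Polynomial

/-- The polynomial `∏_{j < m} (j (j + 1) - X (X + 1))`. -/
noncomputable def centralPoly (m : ℕ) : ℚ[X] :=
  ∏ j ∈ range m, (C ((j : ℚ) * (j + 1)) - X * (X + 1))

lemma centralPoly_succ (m : ℕ) :
    centralPoly (m + 1) = centralPoly m * (C ((m : ℚ) * (m + 1)) - X * (X + 1)) :=
  prod_range_succ _ _

lemma degree_centralPoly (m : ℕ) : (centralPoly m).degree = (2 * m : ℕ) := by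
  have h : ∀ c : ℚ, (C c - X * (X + 1) : ℚ[X]).degree = 2 := by
    intro c
    rw [show (C c - X * (X + 1) : ℚ[X]) = C (-1) * X ^ 2 + C (-1) * X + C c by
      simp only [map_neg, map_one]; ring]
    exact degree_quadratic (by norm_num)
  rw [centralPoly, degree_prod]
  simp only [h, sum_const, card_range]
  rw [nsmul_eq_mul, mul_comm]
  push_cast
  rfl

/-- There is a linear functional with prescribed values on the polynomials `centralPoly m` and
vanishing on the polynomials `(X + 1) * centralPoly m`. -/
lemma exists_functional (c : ℕ → ℚ) : ∃ φ : ℚ[X] →ₗ[ℚ] ℚ,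
    (∀ m, φ (centralPoly m) = c m) ∧ ∀ m, φ ((X + 1) * centralPoly m) = 0 := by
  -- The two families have degrees `2m` and `2m + 1`, so together they contain one polynomial of
  -- each degree and form a basis.
  let S : Polynomial.Sequence ℚ :=
    { elems' := fun i => if Even i then centralPoly (i / 2) else (X + 1) * centralPoly (i / 2)
      degree_eq' := by
        intro i
        have h1 : (X + 1 : ℚ[X]).degree = 1 := degree_X_add_C 1
        rcases Nat.even_or_odd' i with ⟨k, rfl | rfl⟩
        · rw [if_pos (by simp), degree_centralPoly]
          congr 2
          omega
        · rw [if_neg (by simp), degree_mul, h1, degree_centralPoly,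
            show 2 * ((2 * k + 1) / 2) = 2 * k by omega]
          push_cast
          ring }
  have hS : ∀ i, S i =
    if Even i then centralPoly (i / 2) else (X + 1) * centralPoly (i / 2) := fun i => rfl
  let B := S.basis fun i => (leadingCoeff_ne_zero.2 (S.ne_zero i)).isUnit
  refine ⟨B.constr ℚ fun i => if Even i then c (i / 2) else 0, fun m => ?_, fun m => ?_⟩
  · have := B.constr_basis ℚ (fun i => if Even i then c (i / 2) else 0) (2 * m)
    simpa [B, hS] using this
  · have := B.constr_basis ℚ (fun i => if Even i then c (i / 2) else 0) (2 * m + 1)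
    have h2 : (2 * m + 1) / 2 = m := by omega
    simpa [B, hS, h2] using this

variable {φ : ℚ[X] →ₗ[ℚ] ℚ}

/-- The functional vanishes on the multiples of `X + 1` by polynomials in `X (X + 1)`. -/
lemma functional_X_add_one (h0 : ∀ m, φ ((X + 1) * centralPoly m) = 0) (n m : ℕ) :
    φ ((X + 1) * ((X * (X + 1)) ^ n * centralPoly m)) = 0 := by
  induction n generalizing m with
  | zero => simpa using h0 m
  | succ n ih =>
    have : (X + 1) * ((X * (X + 1)) ^ (n + 1) * centralPoly m) =
        ((m : ℚ) * (m + 1)) • ((X + 1) * ((X * (X + 1)) ^ n * centralPoly m)) -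
          (X + 1) * ((X * (X + 1)) ^ n * centralPoly (m + 1)) := by
      rw [centralPoly_succ, smul_eq_C_mul]
      ring
    rw [this, map_sub, map_smul, ih, ih]
    simp

/-- The polynomial `∏_{1 ≤ j ≤ m} (j² - X²)`. -/
noncomputable def evenPoly (m : ℕ) : ℚ[X] := ∏ j ∈ range m, (C (((j : ℚ) + 1) ^ 2) - X ^ 2)

/-- The product `(-X) ∏_{1 ≤ j ≤ m} (j² - X²)` in terms of `centralPoly`. -/
lemma neg_X_mul_evenPoly (m : ℕ) :
    -X * evenPoly m = centralPoly m * (C (m : ℚ) - X) := by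
  induction m with
  | zero => simp [evenPoly, centralPoly]
  | succ m ih =>
    rw [evenPoly, prod_range_succ, ← evenPoly, ← mul_assoc, ih, centralPoly_succ]
    simp only [map_mul, map_add, map_pow, map_one, Nat.cast_add, Nat.cast_one]
    ring

/-- With `m = 0` this gives `φ(X^(2n+2)) = φ(X^(2n+1))`, which matches the repeated last sum of the
Seidel triangle. The values `m! (m+1)!` are what makes the case `n = 0` cancel. -/
lemma functional_evenPoly (h1 : ∀ m, φ (centralPoly m) = m.factorial * (m + 1).factorial)
    (h0 : ∀ m, φ ((X + 1) * centralPoly m) = 0) (n m : ℕ) :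
    φ (X * (X - 1) * (X ^ 2) ^ n * evenPoly m) = 0 := by
  induction n generalizing m with
  | zero =>
    have : X * (X - 1) * (X ^ 2) ^ 0 * evenPoly m =
        (((m : ℚ) + 1) * (m + 2)) • centralPoly m - centralPoly (m + 1) -
          ((m : ℚ) + 2) • ((X + 1) * centralPoly m) := by
      rw [show X * (X - 1) * (X ^ 2) ^ 0 * evenPoly m = -X * evenPoly m * (1 - X) by ring,
        neg_X_mul_evenPoly, centralPoly_succ]
      simp only [smul_eq_C_mul, map_mul, map_add, map_one, map_ofNat]
      ring
    rw [this, map_sub, map_sub, map_smul, map_smul, h0, h1, h1, Nat.factorial_succ (m + 1),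
      Nat.factorial_succ m]
    push_cast
    simp only [smul_eq_mul]
    ring
  | succ n ih =>
    have : X * (X - 1) * (X ^ 2) ^ (n + 1) * evenPoly m =
        (((m : ℚ) + 1) ^ 2) • (X * (X - 1) * (X ^ 2) ^ n * evenPoly m) -
          X * (X - 1) * (X ^ 2) ^ n * evenPoly (m + 1) := by
      rw [evenPoly, evenPoly, prod_range_succ, smul_eq_C_mul]
      ring
    rw [this, map_sub, map_smul, ih, ih]
    simp

lemma seidelOddRow_succ (k j : ℕ) :
    seidelOddRow (k + 1) j = ∑ i ∈ range (j + 1), seidelBack k (seidelOddRow k) i := rfl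

/-- The even rows of the Seidel triangle are values of the functional. -/
lemma seidelBack_eq (h1 : ∀ m, φ (centralPoly m) = m.factorial * (m + 1).factorial)
    (h0 : ∀ m, φ ((X + 1) * centralPoly m) = 0) (n j : ℕ) (hj : j ≤ n) :
    (seidelBack n (seidelOddRow n) j : ℚ) = (-1) ^ n * φ (X ^ (n + j) * (X + 1) ^ (n - j)) := by
  induction n generalizing j with
  | zero =>
    obtain rfl : j = 0 := by omega
    have := h1 0
    simp only [centralPoly, range_zero, prod_empty] at this
    simp [seidelBack, seidelOddRow, this]
  | succ n ih =>
    -- The odd rows are values of `φ` as well. Their first entry is obtained from the vanishing of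
    -- `φ((X+1) (X(X+1))^n)`, the others from partial sums.
    have hodd : ∀ j ≤ n, (seidelOddRow (n + 1) j : ℚ) =
        (-1) ^ (n + 1) * φ (X ^ (n + 1 + j) * (X + 1) ^ (n - j)) := by
      intro j hj
      induction j with
      | zero =>
        have h := functional_X_add_one h0 n 0
        simp only [centralPoly, range_zero, prod_empty, mul_one] at h
        have h2 : X ^ (n + 1 + 0) * (X + 1) ^ (n - 0) =
            (X + 1) * (X * (X + 1)) ^ n - X ^ (n + 0) * (X + 1 : ℚ[X]) ^ (n - 0) := by
          rw [mul_pow, Nat.sub_zero]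
          ring
        rw [seidelOddRow_succ, zero_add, sum_range_one, ih 0 (by omega), h2, map_sub, h]
        ring
      | succ j ihj =>
        have h2 : seidelOddRow (n + 1) (j + 1) =
            seidelOddRow (n + 1) j + seidelBack n (seidelOddRow n) (j + 1) := sum_range_succ _ _
        rw [h2, Nat.cast_add, ihj (by omega), ih (j + 1) hj]
        obtain ⟨k, rfl⟩ : ∃ k, n = j + 1 + k := ⟨n - (j + 1), by omega⟩
        have h3 : X ^ (j + 1 + k + 1 + (j + 1)) * (X + 1) ^ (j + 1 + k - (j + 1)) =
            X ^ (j + 1 + k + 1 + j) * (X + 1) ^ (j + 1 + k - j) -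
              X ^ (j + 1 + k + (j + 1)) * (X + 1 : ℚ[X]) ^ (j + 1 + k - (j + 1)) := by
          rw [show j + 1 + k - (j + 1) = k by omega, show j + 1 + k - j = k + 1 by omega]
          ring
        rw [h3, map_sub]
        ring
    -- Column `n + 1` adds an empty sum of row entries, which is how the last partial sum comes to
    -- be written twice.
    have hlast : seidelBack (n + 1) (seidelOddRow (n + 1)) (n + 1) = seidelOddRow (n + 1) n := by
      rw [seidelBack, Icc_self, sum_singleton, seidelOddRow_succ, seidelOddRow_succ,
        sum_range_succ]
      simp [seidelBack]
    induction hj using Nat.decreasingInduction with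
    | self =>
      rw [hlast, hodd n le_rfl]
      have h := functional_evenPoly h1 h0 n 0
      have h2 : X * (X - 1) * (X ^ 2) ^ n * evenPoly 0 =
          X ^ (n + 1 + (n + 1)) * (X + 1) ^ (n + 1 - (n + 1)) -
            X ^ (n + 1 + n) * (X + 1 : ℚ[X]) ^ (n - n) := by
        simp only [evenPoly, range_zero, prod_empty, Nat.sub_self]
        ring
      rw [h2, map_sub, sub_eq_zero] at h
      rw [h]
    | of_succ j hj ihj =>
      have h2 : seidelBack (n + 1) (seidelOddRow (n + 1)) j = seidelOddRow (n + 1) j +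
          seidelBack (n + 1) (seidelOddRow (n + 1)) (j + 1) := by
        have h4 : Icc (j + 1) (n + 1) = Ioc j (n + 1) := by
          ext
          simp
        rw [seidelBack, seidelBack, h4, add_sum_Ioc_eq_sum_Icc (by omega)]
      rw [h2, Nat.cast_add, ihj, hodd j (by omega)]
      obtain ⟨k, rfl⟩ : ∃ k, n = j + k := ⟨n - j, by omega⟩
      have h3 : X ^ (j + k + 1 + j) * (X + 1) ^ (j + k + 1 - j) =
          X ^ (j + k + 1 + j) * (X + 1) ^ (j + k - j) +
            X ^ (j + k + 1 + (j + 1)) * (X + 1 : ℚ[X]) ^ (j + k + 1 - (j + 1)) := by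
        rw [show j + k + 1 - (j + 1) = k by omega, show j + k - j = k by omega,
          show j + k + 1 - j = k + 1 by omega]
        ring
      rw [h3, map_add]
      ring

/-- Binomial sums of the Motzkin path numbers satisfy the recurrence of the moments. -/
lemma sum_choose_mul (z z' : ℕ → ℚ)
    (hz : ∀ h, z' h = 2 * (h + 1) ^ 2 * z h + (h + 1) * (h + 2) * z (h + 1) +
      (h + 1) * h * z (h - 1)) (m : ℕ) :
    ∑ h ∈ range (m + 1), (m.choose h : ℚ) * z' h =
      (m + 1) * (m + 2) * ∑ h ∈ range (m + 2), ((m + 1).choose h : ℚ) * z h -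
        m * (m + 1) * ∑ h ∈ range (m + 1), (m.choose h : ℚ) * z h := by
  have e1 : ∑ h ∈ range (m + 1), (m.choose h : ℚ) * ((h + 1) * (h + 2) * z (h + 1)) =
      ∑ h ∈ range (m + 2), (m.choose (h - 1) : ℚ) * h * (h + 1) * z h := by
    rw [sum_range_succ' _ (m + 1)]
    simp only [Nat.cast_zero, mul_zero, zero_mul, add_zero, Nat.add_sub_cancel]
    refine sum_congr rfl fun h _ => ?_
    push_cast
    ring
  have e2 : ∑ h ∈ range (m + 1), (m.choose h : ℚ) * ((h + 1) * h * z (h - 1)) =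
      ∑ h ∈ range (m + 2), (m.choose (h + 1) : ℚ) * (h + 1) * (h + 2) * z h := by
    rw [sum_range_succ', sum_range_succ _ (m + 1), sum_range_succ _ m,
      Nat.choose_eq_zero_of_lt (by omega : m < m + 1 + 1),
      Nat.choose_eq_zero_of_lt (by omega : m < m + 1)]
    simp only [Nat.cast_zero, mul_zero, zero_mul, add_zero, Nat.add_sub_cancel]
    refine sum_congr rfl fun h _ => ?_
    push_cast
    ring
  have e3 : ∀ f : ℕ → ℚ, ∑ h ∈ range (m + 1), (m.choose h : ℚ) * f h =
      ∑ h ∈ range (m + 2), (m.choose h : ℚ) * f h := by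
    intro f
    rw [sum_range_succ _ (m + 1), Nat.choose_eq_zero_of_lt (by omega : m < m + 1)]
    simp
  have e0 : ∀ h, (m.choose h : ℚ) * z' h = m.choose h * (2 * (h + 1) ^ 2 * z h) +
      m.choose h * ((h + 1) * (h + 2) * z (h + 1)) + m.choose h * ((h + 1) * h * z (h - 1)) := by
    intro h
    rw [hz]
    ring
  simp only [e0, sum_add_distrib]
  rw [e1, e2, e3, e3, mul_sum, mul_sum, ← sum_add_distrib, ← sum_add_distrib, ← sum_sub_distrib]
  refine sum_congr rfl fun h _ => ?_
  -- After the shifts of index the coefficients of `z h` are compared. The truncated `h - 1` at `h =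
  -- 0` is multiplied by `h`.
  suffices H : (m.choose h : ℚ) * (2 * (h + 1) ^ 2) + m.choose (h - 1) * h * (h + 1) +
      m.choose (h + 1) * (h + 1) * (h + 2) =
      (m + 1) * (m + 2) * (m + 1).choose h - m * (m + 1) * m.choose h by
    linear_combination z h * H
  cases h with
  | zero =>
    simp
    ring
  | succ k =>
    have h1 := Nat.choose_succ_right_eq m (k + 1)
    have h2 := Nat.choose_succ_right_eq m k
    rcases lt_or_ge k m with hk | hk
    · rw [Nat.choose_succ_succ, Nat.add_sub_cancel]
      zify [show k + 1 ≤ m by omega, show k ≤ m by omega] at h1 h2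
      have h1' := congrArg (Int.cast : ℤ → ℚ) h1
      have h2' := congrArg (Int.cast : ℤ → ℚ) h2
      push_cast at h1' h2' ⊢
      simp only [Nat.succ_eq_add_one]
      linear_combination (k + 3 : ℚ) * h1' + (m + k + 3 : ℚ) * h2'
    · rcases hk.eq_or_lt with rfl | hk
      · rw [Nat.choose_eq_zero_of_lt (by omega : m < m + 1 + 1),
          Nat.choose_eq_zero_of_lt (by omega : m < m + 1), Nat.add_sub_cancel, Nat.choose_self,
          Nat.choose_self]
        push_cast
        ring
      · rw [Nat.choose_eq_zero_of_lt (by omega : m < k + 1), Nat.add_sub_cancel,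
          Nat.choose_eq_zero_of_lt hk, Nat.choose_eq_zero_of_lt (by omega : m < k + 1 + 1),
          Nat.choose_eq_zero_of_lt (by omega : m + 1 < k + 1)]
        simp

/-- Multiplication by `-X(X+1)` sends `centralPoly m` to `centralPoly (m + 1) - m (m + 1)
centralPoly m`. By `sum_choose_mul` the binomial transform of the Motzkin numbers, scaled by `m!
(m+1)!`, obeys the same rule. -/
lemma functional_moments (h1 : ∀ m, φ (centralPoly m) = m.factorial * (m + 1).factorial)
    (z : ℕ → ℕ → ℚ) (hz0 : ∀ h, z 0 h = if h = 0 then 1 else 0)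
    (hz : ∀ n h, z (n + 1) h = 2 * (h + 1) ^ 2 * z n h + (h + 1) * (h + 2) * z n (h + 1) +
      (h + 1) * h * z n (h - 1)) (n m : ℕ) :
    φ ((-(X * (X + 1))) ^ n * centralPoly m) =
      m.factorial * (m + 1).factorial * ∑ h ∈ range (m + 1), (m.choose h : ℚ) * z n h := by
  induction n generalizing m with
  | zero => simp [h1, hz0]
  | succ n ih =>
    have : (-(X * (X + 1))) ^ (n + 1) * centralPoly m =
        (-(X * (X + 1))) ^ n * centralPoly (m + 1) -
          ((m : ℚ) * (m + 1)) • ((-(X * (X + 1))) ^ n * centralPoly m) := by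
      rw [centralPoly_succ, smul_eq_C_mul]
      ring
    rw [this, map_sub, map_smul, ih, ih, sum_choose_mul (z n) _ (hz n), Nat.factorial_succ (m + 1),
      Nat.factorial_succ m, smul_eq_mul]
    push_cast
    ring

lemma medianGenocchi_eq (z : ℕ → ℕ → ℚ) (hz0 : ∀ h, z 0 h = if h = 0 then 1 else 0)
    (hz : ∀ n h, z (n + 1) h = 2 * (h + 1) ^ 2 * z n h + (h + 1) * (h + 2) * z n (h + 1) +
      (h + 1) * h * z n (h - 1)) (n : ℕ) : (medianGenocchi n : ℚ) = z n 0 := by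
  obtain ⟨φ, h1, h0⟩ := exists_functional fun m => m.factorial * (m + 1).factorial
  have h := functional_moments h1 z hz0 hz n 0
  simp only [centralPoly, range_zero, prod_empty, mul_one, zero_add, sum_range_one,
    Nat.choose_self, Nat.factorial_zero, Nat.factorial_one, Nat.cast_one, one_mul] at h
  rw [medianGenocchi, seidelBack_eq h1 h0 n 0 (by omega), ← h, ← smul_eq_mul, ← map_smul,
    smul_eq_C_mul, neg_pow (X * (X + 1) : ℚ[X]), mul_pow]
  simp

lemma pqNat_one_one (n : ℕ) : pqNat (1 : ℚ) 1 n = n := by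
  simp [pqNat]

lemma card_normalizedEPerms (n : ℕ) :
    ((normalizedEPerms n).card : ℚ) = (medianGenocchi n : ℚ) / 2 ^ n := by
  have h := sum_normalizedEPerms (1 : ℚ) 1 1 (by norm_num) n
  simp only [one_pow, mul_one, sum_const, nsmul_eq_mul] at h
  -- One factor `2` per step turns the weights `(h+1)²`, `(h+1)(h+2)/2`, `(h+1)h/2` into those of
  -- the moment recurrence.
  rw [h, medianGenocchi_eq (fun n h => 2 ^ n * motzkin (fun h => pqNat (1 : ℚ) 1 (h + 1) ^ 2)
    (fun h => pqNat (1 : ℚ) 1 (h + 1) * pqNat 1 1 (h + 2) / (1 + 1))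
    (fun h => pqNat (1 : ℚ) 1 (h + 1) * pqNat 1 1 h / (1 + 1)) n h),
    mul_div_cancel_left₀ _ (by positivity)]
  · intro h
    simp [motzkin]
  · intro n h
    rw [motzkin]
    simp only [pqNat_one_one]
    push_cast
    ring

end Genocchi

/-- Since `[2] = p + q`, an up step from `h` followed by a down step from `h + 1` has weight equal
to the squared binomial times `t`. -/
lemma hasJFraction_normalizedEPerms {K : Type*} [Field K] (p q t : K) (hpq : p + q ≠ 0) :
    HasJFraction
      (PowerSeries.mk fun n => ∑ σ ∈ normalizedEPerms n,
        p ^ (res σ - des σ) * q ^ (les σ - des σ) * t ^ des σ)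
      (fun n => pqNat p q (n + 1) ^ 2) (fun n => pqBinom p q (n + 1) 2 ^ 2 * t) := by
  simp only [sum_normalizedEPerms p q t hpq]
  refine hasJFraction_motzkin _ _ _ _ (fun h => ?_) ?_
  · simp only [pqBinom, prod_range_succ, range_zero, prod_empty, one_mul, Nat.sub_zero, zero_add]
    have h1 : pqNat p q 1 = 1 := by simp [pqNat]
    have h2 : pqNat p q (1 + 1) = p + q := by simp [pqNat, sum_range_succ]
    rw [h1, h2, show h + 1 + 1 - 1 = h + 1 by omega]
    field_simp
  · simp [pqNat]

end EvenOdd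

theorem mainTheorem10 :
    (∀ (n : ℕ), ∀ σ ∈ EvenOdd.normalizedEPerms n,
      EvenOdd.des σ ≤ EvenOdd.res σ ∧ EvenOdd.des σ ≤ EvenOdd.les σ) ∧
    (∀ (K : Type*) [Field K] (p q t : K), p + q ≠ 0 →
      EvenOdd.HasJFraction
        (PowerSeries.mk fun n => ∑ σ ∈ EvenOdd.normalizedEPerms n,
          p ^ (EvenOdd.res σ - EvenOdd.des σ) * q ^ (EvenOdd.les σ - EvenOdd.des σ) *
            t ^ EvenOdd.des σ)
        (fun n => EvenOdd.pqNat p q (n + 1) ^ 2)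
        (fun n => EvenOdd.pqBinom p q (n + 1) 2 ^ 2 * t)) ∧
    (∀ n : ℕ, ((EvenOdd.normalizedEPerms n).card : ℚ) =
      (EvenOdd.medianGenocchi n : ℚ) / 2 ^ n) := by
  refine ⟨fun n σ hσ => ?_, fun K _ p q t hpq => ?_, EvenOdd.card_normalizedEPerms⟩
  · have h : EvenOdd.IsNormalized σ := (Finset.mem_filter.1 hσ).2
    exact ⟨h.des_le_res, h.des_le_les⟩
  · exact EvenOdd.hasJFraction_normalizedEPerms p q t hpq
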